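/- For graphs $G,H$ let $G+H$ denote their join (the disjoint union of $G$ and $H$ together with all edges between $G$ and $H$), and let $nG$ denote the join of $n$ copies of $G$. An embedding of a finite graph in $S^3$ is tame if some homeomorphism of $S^3$ carries its image to a finite union of great circle arcs. A graph is achirally embeddable in $S^3$ if it has a tame embedding $\Gamma$ in $S^3$ for which there is an ambient isotopy of $S^3$ taking $\Gamma$ to its mirror image, with vertices going to vertices. **Theorem.** Let $\gamma$ be a complete multipartite graph of the form $$\gamma = 4G_1+2G_2+G_3+K_{q_1,q_2,q_3},$$ where $G_1,G_2,G_3$ and $K_{q_1,q_2,q_3}$ are (possibly empty) finite complete multipartite graphs, $q_1,q_2,q_3\ge 0$, such that all partite sets of $G_2$ have even size and all partite sets of $G_3$ have size divisible by $4$. Suppose that one of the following conditions holds: 1. two or three of the $q_i$ are $0$; 2. two of the $q_i$ are odd and equal, and the third is $0$; 3. two of the $q_i$ are odd and equal, the third is $\equiv 1 \pmod 4$, and $G_1=\emptyset$; 4. one $q_i\equiv 2 \pmod 4$, one $q_i\equiv 1 \pmod 4$, and the third is $0$; 5. two of the $q_i$ are $\equiv 2 \pmod 4$, the third is $0$, and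 $G_1=\emptyset$. Then $\gamma$ is achirally embeddable in $S^3$. -/

import Mathlib

/-- The join `G + H`: the disjoint union of `G` and `H` together with all edges between them. -/
def SimpleGraph.join {V W : Type*} (G : SimpleGraph V) (H : SimpleGraph W) :
    SimpleGraph (V ⊕ W) :=
  (G ⊕g H) ⊔ completeBipartiteGraph V W

/-- The join `nG` of `n` copies of `G`; the vertex `(i, v)` is the vertex `v` of the `i`-th copy. -/
def SimpleGraph.joinCopies {V : Type*} (n : ℕ) (G : SimpleGraph V) : SimpleGraph (Fin n × V) where
  Adj x y := x.1 ≠ y.1 ∨ G.Adj x.2 y.2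
  symm := ⟨fun _ _ h => h.imp Ne.symm fun h' => h'.symm⟩
  loopless := ⟨fun x h => h.elim (fun h' => h' rfl) fun h' => G.loopless.irrefl x.2 h'⟩

/-- The complete multipartite graph `K_{m 0, …, m (k-1)}`; some of the sizes may be `0`. -/
abbrev completeMultipartite {k : ℕ} (m : Fin k → ℕ) : SimpleGraph (Σ i, Fin (m i)) :=
  SimpleGraph.completeMultipartiteGraph fun i => Fin (m i)

/-- The 3-sphere. -/
abbrev S3 : Type := Metric.sphere (0 : EuclideanSpace ℝ (Fin 4)) 1

/-- The reflection of the 3-sphere in an equatorial 2-sphere. -/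
noncomputable def S3.mirror (x : S3) : S3 :=
  ⟨!₂[-x.1 0, x.1 1, x.1 2, x.1 3], by
    have h : ‖x.1‖ = 1 := mem_sphere_zero_iff_norm.mp x.2
    rw [EuclideanSpace.norm_eq] at h
    rw [mem_sphere_zero_iff_norm, EuclideanSpace.norm_eq]
    simpa [Fin.sum_univ_four] using h⟩

/-- For `q ≠ -p`, the shortest great circle arc between `p` and `q` (the point `p` if `p = q`). -/
def S3.geodesicArc (p q : S3) : Set S3 :=
  {x | ∃ a b : ℝ, 0 ≤ a ∧ 0 ≤ b ∧ x.1 = a • p.1 + b • q.1}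

/-- A subset of the 3-sphere is tame (as a one-dimensional object) if some homeomorphism of the
3-sphere carries it to a finite union of geodesic arcs. -/
def S3.IsTame (A : Set S3) : Prop :=
  ∃ (φ : S3 ≃ₜ S3) (s : Finset (S3 × S3)), (∀ p ∈ s, p.2 ≠ -p.1) ∧
    φ '' A = ⋃ p ∈ s, S3.geodesicArc p.1 p.2

/-- An ambient isotopy of the 3-sphere: a continuous family of homeomorphisms that starts at the
identity. -/
structure S3.AmbientIsotopy where
  toFun : unitInterval → S3 ≃ₜ S3
  continuous_toFun : Continuous fun p : unitInterval × S3 => toFun p.1 p.2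
  map_zero : toFun 0 = Homeomorph.refl S3

/-- A (topological) embedding of a graph in the 3-sphere: vertices go to distinct points, the edge
`uv` goes to an arc from the image of `u` to the image of `v` that contains no other
vertex, and distinct edges meet only in vertices. -/
structure SpatialEmbedding {V : Type*} (G : SimpleGraph V) where
  vert : V → S3
  arc : G.edgeSet → Set S3
  vert_injective : Function.Injective vert
  arc_eq_range : ∀ (u v : V) (h : G.Adj u v), ∃ γ : Path (vert u) (vert v),
    Function.Injective γ ∧ arc ⟨s(u, v), h⟩ = Set.range γ
  vert_mem_arc : ∀ (e : G.edgeSet) (w : V), vert w ∈ arc e → w ∈ e.1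
  arc_inter_arc : ∀ e e' : G.edgeSet, e ≠ e' → arc e ∩ arc e' ⊆ Set.range vert

/-- The embedded graph as a set of points. -/
def SpatialEmbedding.carrier {V : Type*} {G : SimpleGraph V} (Γ : SpatialEmbedding G) : Set S3 :=
  Set.range Γ.vert ∪ ⋃ e, Γ.arc e

/-- An embedded graph is achiral if an ambient isotopy takes it to its mirror image, as a set of
points with a distinguished set of vertices. -/
def SpatialEmbedding.IsAchiral {V : Type*} {G : SimpleGraph V} (Γ : SpatialEmbedding G) : Prop :=
  ∃ F : S3.AmbientIsotopy,
    F.toFun 1 '' Γ.carrier = S3.mirror '' Γ.carrier ∧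
    F.toFun 1 '' Set.range Γ.vert = S3.mirror '' Set.range Γ.vert

/-- A graph is achirally embeddable in the 3-sphere if it has a (tame) achiral embedding. -/
def SimpleGraph.AchirallyEmbeddable {V : Type*} (G : SimpleGraph V) : Prop :=
  ∃ Γ : SpatialEmbedding G, S3.IsTame Γ.carrier ∧ Γ.IsAchiral

/-! Let R be the rotoreflection (x₀,x₁,x₂,x₃) ↦ (-x₀,-x₂,x₁,x₃). It is a quarter turn followed by a
mirror reflection, and the quarter turn is isotopic to the identity. So every R-invariant spatial
graph is achiral, and it suffices to draw the graph with great circle arcs that R permutes.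

Most vertices form free orbits on the curve z ↦ (Re z², Re z, Im z, 1), |z| = 1, where R acts by z ↦
iz. Some linear form vanishing at x, y, w restricts to a Laurent polynomial with leading terms z² +
z⁻² and fourth root (xyw)⁻¹. All z are chosen slightly ahead of fourth roots of unity, so no four
have product 1. Hence four distinct orbit vertices are linearly independent
(`coeff_eq_zero_of_four`), and arcs between them meet only in vertices.

The remaining vertices, at most four from K_{q₁,q₂,q₃}, lie on the circle x₁ = x₂ = 0, which R²
fixes and R reflects. The form above vanishes there where p₁ + p₂ r = 0 with r = Re(xy + xw + yw),
and 1/2 ≤ |r| ≤ 3; `Admissible` excludes these points (`axis_coeff_eq_zero`). An arc between orbit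
vertices can meet the circle only if it joins z to -z, and it does so on an inadmissible ray. Only
orbits of 4G₁ contain such edges, since every other orbit has z and -z in one partite set. So either
the arcs on the circle stay near a pole (0, 1), or G₁ is empty and a triangle or quadrangle may run
around the whole circle. The five conditions describe which remainders of K_{q₁,q₂,q₃} can be drawn
in this way, with R fixing its parts or swapping two of them. -/

/-- Euclidean four-space. -/
abbrev E4 : Type := EuclideanSpace ℝ (Fin 4)

/-! ### The rotoreflection and the quarter turn -/

namespace E4

theorem norm_eq_of_sq {x y : E4}
    (h : x 0 ^ 2 + x 1 ^ 2 + x 2 ^ 2 + x 3 ^ 2 = y 0 ^ 2 + y 1 ^ 2 + y 2 ^ 2 + y 3 ^ 2) :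
    ‖x‖ = ‖y‖ := by
  simp only [EuclideanSpace.norm_eq, Fin.sum_univ_four, Real.norm_eq_abs, sq_abs, h]

/-- The rotation by the angle `θ` in the plane of the middle coordinates. -/
noncomputable def rotate (θ : ℝ) (x : E4) : E4 :=
  !₂[x 0, Real.cos θ * x 1 - Real.sin θ * x 2, Real.sin θ * x 1 + Real.cos θ * x 2, x 3]

theorem norm_rotate (θ : ℝ) (x : E4) : ‖rotate θ x‖ = ‖x‖ := by
  apply norm_eq_of_sq
  simp only [rotate, PiLp.toLp_apply, Matrix.cons_val]
  linear_combination (x 1 ^ 2 + x 2 ^ 2) * Real.sin_sq_add_cos_sq θ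

theorem rotate_rotate_of_add_eq_zero {θ η : ℝ} (h : θ + η = 0) (x : E4) :
    rotate θ (rotate η x) = x := by
  obtain rfl : η = -θ := by linarith
  have hs := Real.sin_sq_add_cos_sq θ
  ext i
  fin_cases i
  · simp [rotate]
  · simp [rotate]; linear_combination x 1 * hs
  · simp [rotate]; linear_combination x 2 * hs
  · simp [rotate]

/-- The quarter turn in the plane of the middle coordinates followed by the reflection in the
first coordinate. -/
noncomputable def rotoreflect : E4 →ₗ[ℝ] E4 where
  toFun x := !₂[-x 0, -x 2, x 1, x 3]
  map_add' x y := by ext i; fin_cases i <;> simp <;> ring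
  map_smul' a x := by ext i; fin_cases i <;> simp

theorem rotoreflect_apply (x : E4) : rotoreflect x = !₂[-x 0, -x 2, x 1, x 3] := rfl

theorem norm_rotoreflect (x : E4) : ‖rotoreflect x‖ = ‖x‖ := by
  apply norm_eq_of_sq
  simp only [rotoreflect_apply, PiLp.toLp_apply, Matrix.cons_val]
  ring

theorem rotoreflect_four (x : E4) :
    rotoreflect (rotoreflect (rotoreflect (rotoreflect x))) = x := by
  ext i; fin_cases i <;> simp [rotoreflect_apply]

end E4

namespace S3

theorem norm_coe (x : S3) : ‖x.1‖ = 1 := mem_sphere_zero_iff_norm.mp x.2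

/-- The rotation of the 3-sphere by the angle `θ` in the plane of the middle coordinates. -/
noncomputable def rotate (θ : ℝ) (x : S3) : S3 :=
  ⟨E4.rotate θ x.1, by rw [mem_sphere_zero_iff_norm, E4.norm_rotate, norm_coe]⟩

theorem continuous_rotate : Continuous fun p : ℝ × S3 => rotate p.1 p.2 := by
  refine Continuous.subtype_mk ?_ _
  refine (PiLp.continuous_toLp 2 _).comp (continuous_pi fun i => ?_)
  have h : ∀ i : Fin 4, Continuous fun p : ℝ × S3 => p.2.1 i := fun i => by fun_prop
  have h0 := h 0
  have h1 := h 1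
  have h2 := h 2
  have h3 := h 3
  fin_cases i
  · exact h0
  · exact ((Real.continuous_cos.comp continuous_fst).mul h1).sub
      ((Real.continuous_sin.comp continuous_fst).mul h2)
  · exact ((Real.continuous_sin.comp continuous_fst).mul h1).add
      ((Real.continuous_cos.comp continuous_fst).mul h2)
  · exact h3

/-- `S3.rotate` as a homeomorphism. -/
noncomputable def rotateHomeomorph (θ : ℝ) : S3 ≃ₜ S3 where
  toFun := rotate θ
  invFun := rotate (-θ)
  left_inv x := Subtype.ext (E4.rotate_rotate_of_add_eq_zero (by ring) x.1)
  right_inv x := Subtype.ext (E4.rotate_rotate_of_add_eq_zero (by ring) x.1)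
  continuous_toFun := continuous_rotate.comp (by fun_prop : Continuous fun x : S3 => (θ, x))
  continuous_invFun := continuous_rotate.comp (by fun_prop : Continuous fun x : S3 => (-θ, x))

/-- The ambient isotopy from the identity to the quarter turn. -/
noncomputable def quarterTurn : S3.AmbientIsotopy where
  toFun t := rotateHomeomorph (t * (Real.pi / 2))
  continuous_toFun := continuous_rotate.comp
    (by fun_prop : Continuous fun p : unitInterval × S3 => ((p.1 : ℝ) * (Real.pi / 2), p.2))
  map_zero := by
    ext x i
    fin_cases i <;> simp [rotateHomeomorph, rotate, E4.rotate]

/-- The rotoreflection of the 3-sphere of order four. -/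
noncomputable def rotoreflect (x : S3) : S3 :=
  ⟨E4.rotoreflect x.1, by rw [mem_sphere_zero_iff_norm, E4.norm_rotoreflect, norm_coe]⟩

theorem rotoreflect_four (x : S3) :
    rotoreflect (rotoreflect (rotoreflect (rotoreflect x))) = x :=
  Subtype.ext (E4.rotoreflect_four x.1)

theorem quarterTurn_one (x : S3) : quarterTurn.toFun 1 x = mirror (rotoreflect x) := by
  ext i
  fin_cases i <;>
    simp [quarterTurn, rotateHomeomorph, rotate, E4.rotate, mirror, rotoreflect,
      E4.rotoreflect_apply]

/-- One inclusion is enough because the order is four: the cube of the map supplies preimages. -/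
theorem image_rotoreflect_eq {A : Set S3} (h : Set.MapsTo rotoreflect A A) :
    rotoreflect '' A = A :=
  h.image_subset.antisymm fun x hx => ⟨_, h (h (h hx)), rotoreflect_four x⟩

theorem quarterTurn_one_image {A : Set S3} (h : Set.MapsTo rotoreflect A A) :
    quarterTurn.toFun 1 '' A = mirror '' A := by
  conv_rhs => rw [← image_rotoreflect_eq h, Set.image_image]
  exact Set.image_congr fun x _ => quarterTurn_one x

/-! ### Geodesic arcs -/

theorem geodesicArc_comm (p q : S3) : geodesicArc p q = geodesicArc q p := by
  ext x
  constructor <;> rintro ⟨a, b, ha, hb, h⟩ <;> exact ⟨b, a, hb, ha, by rw [h, add_comm]⟩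

theorem geodesicArc_self (p : S3) : geodesicArc p p = {p} := by
  ext x
  constructor
  · rintro ⟨a, b, ha, hb, h⟩
    rw [← add_smul] at h
    have h1 : a + b = 1 := by
      have := norm_coe x
      rwa [h, norm_smul, norm_coe, mul_one, Real.norm_of_nonneg (by positivity)] at this
    rw [h1, one_smul] at h
    exact Subtype.ext h
  · rintro rfl
    exact ⟨1, 0, zero_le_one, le_rfl, by simp⟩

theorem rotoreflect_mem_geodesicArc {p q x : S3} (h : x ∈ geodesicArc p q) :
    rotoreflect x ∈ geodesicArc (rotoreflect p) (rotoreflect q) := by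
  obtain ⟨a, b, ha, hb, h⟩ := h
  exact ⟨a, b, ha, hb, by simp [rotoreflect, h]⟩

/-- The radial projection to the 3-sphere. -/
noncomputable def ofVec (v : E4) (hv : v ≠ 0) : S3 :=
  ⟨‖v‖⁻¹ • v, by
    rw [mem_sphere_zero_iff_norm, norm_smul, norm_inv, norm_norm,
      inv_mul_cancel₀ (norm_ne_zero_iff.mpr hv)]⟩

theorem ofVec_eq_of_smul {v : E4} (hv : v ≠ 0) {e : ℝ} (he : 0 ≤ e) {x : S3}
    (h : x.1 = e • v) : x = ofVec v hv := by
  have h1 : e * ‖v‖ = 1 := by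
    have := norm_coe x
    rwa [h, norm_smul, Real.norm_of_nonneg he] at this
  refine Subtype.ext ?_
  rw [h, eq_inv_of_mul_eq_one_left h1]
  rfl

/-- By linear independence the segment from `p` to `q` misses the origin, and no two of its points
lie on one ray, so its radial projection is an injective path. -/
theorem exists_path_geodesicArc {p q : S3}
    (h : ∀ a b : ℝ, a • p.1 + b • q.1 = 0 → a = 0 ∧ b = 0) :
    ∃ γ : Path p q, Function.Injective γ ∧ geodesicArc p q = Set.range γ := by
  have hne : ∀ t : unitInterval, (1 - t : ℝ) • p.1 + (t : ℝ) • q.1 ≠ 0 := fun t ht => by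
    obtain ⟨h1, h2⟩ := h _ _ ht
    linarith
  refine ⟨⟨⟨fun t => ofVec _ (hne t), ?_⟩, ?_, ?_⟩, ?_, ?_⟩
  · have hc : Continuous fun t : unitInterval => (1 - t : ℝ) • p.1 + (t : ℝ) • q.1 := by fun_prop
    exact Continuous.subtype_mk
      ((hc.norm.inv₀ fun t => norm_ne_zero_iff.mpr (hne t)).smul hc) _
  · exact (ofVec_eq_of_smul (hne 0) zero_le_one (by simp)).symm
  · exact (ofVec_eq_of_smul (hne 1) zero_le_one (by simp)).symm
  · intro s t hst
    have hst' := congrArg Subtype.val hst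
    simp only [ofVec, Path.coe_mk_mk] at hst'
    set m := ‖(1 - s : ℝ) • p.1 + (s : ℝ) • q.1‖⁻¹ with hm
    set n := ‖(1 - t : ℝ) • p.1 + (t : ℝ) • q.1‖⁻¹ with hn
    have hm0 : m ≠ 0 := inv_ne_zero (norm_ne_zero_iff.mpr (hne s))
    obtain ⟨h1, h2⟩ := h (m * (1 - s) - n * (1 - t)) (m * s - n * t) (by
      refine Eq.trans ?_ (sub_eq_zero.mpr hst')
      module)
    have hmn : m = n := by linarith
    rw [hmn] at h2 hm0
    exact Subtype.ext (mul_left_cancel₀ hm0 (by linarith))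
  · ext x
    constructor
    · rintro ⟨a, b, ha, hb, hx⟩
      have hab : 0 < a + b := by
        rcases ha.lt_or_eq with ha | rfl
        · linarith
        rcases hb.lt_or_eq with hb | rfl
        · linarith
        have := norm_coe x
        simp [hx] at this
      let t : unitInterval :=
        ⟨b / (a + b), by positivity, div_le_one_of_le₀ (by linarith) hab.le⟩
      refine ⟨t, (ofVec_eq_of_smul (hne t) hab.le ?_).symm⟩
      simp only [t]
      rw [hx, smul_add, smul_smul, smul_smul]
      congr 2 <;> field_simp
      ring
    · rintro ⟨t, rfl⟩
      refine ⟨‖(1 - t : ℝ) • p.1 + (t : ℝ) • q.1‖⁻¹ * (1 - t),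
        ‖(1 - t : ℝ) • p.1 + (t : ℝ) • q.1‖⁻¹ * t,
        mul_nonneg (by positivity) (by linarith [t.2.2]), mul_nonneg (by positivity) t.2.1, ?_⟩
      rw [mul_smul, mul_smul, ← smul_add]
      rfl

end S3

/-! ### Symmetric drawings with great circle arcs -/

/-- A placement of the vertices of a graph in `ℝ⁴` whose radial projection to the 3-sphere,
with great circle arcs as edges, is an embedding invariant under the rotoreflection. -/
structure IsSymmetricDrawing {V : Type*} (G : SimpleGraph V) (P : V → E4) (π : V → V) : Prop where
  ne_zero : ∀ v, P v ≠ 0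
  ray_injective : ∀ u v (a : ℝ), 0 ≤ a → P u = a • P v → u = v
  not_antipodal : ∀ u v, G.Adj u v → ∀ a b : ℝ, 0 ≤ a → 0 ≤ b → a • P u + b • P v = 0 →
    a = 0 ∧ b = 0
  mem_cone : ∀ u v w, G.Adj u v → ∀ a b : ℝ, 0 ≤ a → 0 ≤ b → a • P u + b • P v = P w →
    w = u ∨ w = v
  cone_inter_cone : ∀ u v w y, G.Adj u v → G.Adj w y → s(u, v) ≠ s(w, y) → ∀ a b c d : ℝ,
    0 ≤ a → 0 ≤ b → 0 ≤ c → 0 ≤ d → a • P u + b • P v = c • P w + d • P y →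
    ∃ x, ∃ e : ℝ, 0 ≤ e ∧ a • P u + b • P v = e • P x
  adj_map : ∀ u v, G.Adj u v → G.Adj (π u) (π v)
  apply_map : ∀ v, P (π v) = E4.rotoreflect (P v)

namespace IsSymmetricDrawing

variable {V : Type*} {G : SimpleGraph V} {P : V → E4} {π : V → V}

/-- The radial projection of a vertex. -/
noncomputable def vert (h : IsSymmetricDrawing G P π) (v : V) : S3 := S3.ofVec (P v) (h.ne_zero v)

theorem vert_map (h : IsSymmetricDrawing G P π) (v : V) :
    h.vert (π v) = S3.rotoreflect (h.vert v) :=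
  Subtype.ext <| by
    simp [vert, S3.ofVec, S3.rotoreflect, h.apply_map, E4.norm_rotoreflect]

theorem exists_of_mem_arc (h : IsSymmetricDrawing G P π) {u v : V} {x : S3}
    (hx : x ∈ S3.geodesicArc (h.vert u) (h.vert v)) :
    ∃ a b : ℝ, 0 ≤ a ∧ 0 ≤ b ∧ x.1 = a • P u + b • P v := by
  obtain ⟨a, b, ha, hb, hx⟩ := hx
  refine ⟨a * ‖P u‖⁻¹, b * ‖P v‖⁻¹, by positivity, by positivity, ?_⟩
  rw [hx, mul_smul, mul_smul]
  rfl

theorem vert_injective (h : IsSymmetricDrawing G P π) : Function.Injective h.vert := by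
  intro u v huv
  have h0 : ‖P u‖ ≠ 0 := norm_ne_zero_iff.mpr (h.ne_zero u)
  have h1 : ‖P u‖⁻¹ • P u = ‖P v‖⁻¹ • P v := congrArg Subtype.val huv
  refine h.ray_injective u v (‖P u‖ * ‖P v‖⁻¹) (by positivity) ?_
  rw [mul_smul, ← h1, smul_smul, mul_inv_cancel₀ h0, one_smul]

/-- Coefficients of equal sign are excluded by `not_antipodal`; coefficients of opposite sign would
put both vertices on one ray. -/
theorem linearIndependent_of_adj (h : IsSymmetricDrawing G P π) {u v : V} (huv : G.Adj u v)
    {a b : ℝ} (hab : a • P u + b • P v = 0) : a = 0 ∧ b = 0 := by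
  have key : ∀ u v, G.Adj u v → ∀ a b : ℝ, 0 ≤ a → b ≤ 0 → a • P u + b • P v = 0 →
      a = 0 ∧ b = 0 := by
    intro u v huv a b ha hb hab
    have ha0 : a = 0 := by
      by_contra ha0
      refine huv.ne (h.ray_injective u v (a⁻¹ * -b)
        (mul_nonneg (by positivity) (by linarith)) ?_)
      have : a • P u = (-b) • P v := by rw [neg_smul]; exact eq_neg_of_add_eq_zero_left hab
      rw [mul_smul, ← this, smul_smul, inv_mul_cancel₀ ha0, one_smul]
    subst ha0
    refine ⟨rfl, ?_⟩
    simpa [h.ne_zero v] using hab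
  rcases le_total 0 a with ha | ha <;> rcases le_total 0 b with hb | hb
  · exact h.not_antipodal u v huv a b ha hb hab
  · exact key u v huv a b ha hb hab
  · exact (key v u huv.symm b a hb ha (by rw [add_comm]; exact hab)).symm
  · have := h.not_antipodal u v huv (-a) (-b) (by linarith) (by linarith)
      (by rw [neg_smul, neg_smul, ← neg_add, hab, neg_zero])
    simpa using this

theorem linearIndependent_vert (h : IsSymmetricDrawing G P π) {u v : V} (huv : G.Adj u v)
    (a b : ℝ) (hab : a • (h.vert u).1 + b • (h.vert v).1 = 0) : a = 0 ∧ b = 0 := by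
  have hu : ‖P u‖⁻¹ ≠ 0 := inv_ne_zero (norm_ne_zero_iff.mpr (h.ne_zero u))
  have hv : ‖P v‖⁻¹ ≠ 0 := inv_ne_zero (norm_ne_zero_iff.mpr (h.ne_zero v))
  have := h.linearIndependent_of_adj huv (a := a * ‖P u‖⁻¹) (b := b * ‖P v‖⁻¹)
    (by rw [mul_smul, mul_smul]; exact hab)
  simpa [hu, hv, -inv_eq_zero] using this

theorem vert_ne_neg (h : IsSymmetricDrawing G P π) {u v : V} (huv : G.Adj u v) :
    h.vert v ≠ -h.vert u := by
  intro hneg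
  have := h.linearIndependent_vert huv 1 1 (by rw [hneg]; simp)
  exact one_ne_zero this.1

/-- The embedding with great circle arcs as edges. -/
noncomputable def toSpatialEmbedding (h : IsSymmetricDrawing G P π) : SpatialEmbedding G where
  vert := h.vert
  arc e := Sym2.lift ⟨fun u v => S3.geodesicArc (h.vert u) (h.vert v),
    fun _ _ => S3.geodesicArc_comm _ _⟩ e.1
  vert_injective := h.vert_injective
  arc_eq_range u v huv := S3.exists_path_geodesicArc (h.linearIndependent_vert huv)
  vert_mem_arc := by
    rintro ⟨e, he⟩ w hw
    induction e using Sym2.ind with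
    | _ u v =>
      obtain ⟨a, b, ha, hb, hx⟩ := h.exists_of_mem_arc (hw : h.vert w ∈ S3.geodesicArc _ _)
      have hn : ‖P w‖ ≠ 0 := norm_ne_zero_iff.mpr (h.ne_zero w)
      refine Sym2.mem_iff.mpr
        (h.mem_cone u v w he (‖P w‖ * a) (‖P w‖ * b) (by positivity) (by positivity) ?_)
      rw [mul_smul, mul_smul, ← smul_add, ← hx]
      simp only [vert, S3.ofVec]
      rw [smul_smul, mul_inv_cancel₀ hn, one_smul]
  arc_inter_arc := by
    rintro ⟨e, he⟩ ⟨e', he'⟩ hne x ⟨hx, hx'⟩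
    induction e using Sym2.ind with
    | _ u v =>
      induction e' using Sym2.ind with
      | _ w y =>
        obtain ⟨a, b, ha, hb, hx⟩ := h.exists_of_mem_arc (hx : x ∈ S3.geodesicArc _ _)
        obtain ⟨c, d, hc, hd, hx'⟩ := h.exists_of_mem_arc (hx' : x ∈ S3.geodesicArc _ _)
        obtain ⟨z, e, he0, hz⟩ := h.cone_inter_cone u v w y he he'
          (fun hs => hne (Subtype.ext hs)) a b c d ha hb hc hd (hx.symm.trans hx')
        exact ⟨z, (S3.ofVec_eq_of_smul (h.ne_zero z) he0 (hx.trans hz)).symm⟩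

theorem mem_carrier (h : IsSymmetricDrawing G P π) (x : S3) :
    x ∈ h.toSpatialEmbedding.carrier ↔ (∃ v, h.vert v = x) ∨
      ∃ u v, G.Adj u v ∧ x ∈ S3.geodesicArc (h.vert u) (h.vert v) := by
  refine or_congr Iff.rfl ?_
  rw [Set.mem_iUnion]
  constructor
  · rintro ⟨⟨e, he⟩, hx⟩
    induction e using Sym2.ind with
    | _ u v => exact ⟨u, v, he, hx⟩
  · rintro ⟨u, v, huv, hx⟩
    exact ⟨⟨s(u, v), huv⟩, hx⟩

theorem isTame_carrier [Finite V] (h : IsSymmetricDrawing G P π) :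
    S3.IsTame h.toSpatialEmbedding.carrier := by
  classical
  cases nonempty_fintype V
  let s : Finset (V × V) := Finset.univ.filter fun p => p.1 = p.2 ∨ G.Adj p.1 p.2
  -- The diagonal pairs give one-point arcs, which account for isolated vertices.
  refine ⟨Homeomorph.refl S3, s.image fun p => (h.vert p.1, h.vert p.2), ?_, ?_⟩
  · intro p hp
    obtain ⟨⟨u, v⟩, huv, rfl⟩ := Finset.mem_image.mp hp
    rcases (Finset.mem_filter.mp huv).2 with huv | huv
    · obtain rfl : u = v := huv
      exact ne_neg_of_mem_unit_sphere ℝ _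
    · exact h.vert_ne_neg huv
  · refine (Set.image_id _).trans (Set.ext fun x => ?_)
    simp only [mem_carrier, Set.mem_iUnion,
      Finset.mem_image, s, Finset.mem_filter, Finset.mem_univ, true_and, exists_prop]
    constructor
    · rintro (⟨v, rfl⟩ | ⟨u, v, huv, hx⟩)
      · exact ⟨_, ⟨(v, v), Or.inl rfl, rfl⟩, by simp [S3.geodesicArc_self]⟩
      · exact ⟨_, ⟨(u, v), Or.inr huv, rfl⟩, hx⟩
    · rintro ⟨_, ⟨⟨u, v⟩, huv | huv, rfl⟩, hx⟩
      · obtain rfl : u = v := huv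
        rw [S3.geodesicArc_self] at hx
        exact Or.inl ⟨u, hx.symm⟩
      · exact Or.inr ⟨u, v, huv, hx⟩

theorem achirallyEmbeddable [Finite V] (h : IsSymmetricDrawing G P π) :
    G.AchirallyEmbeddable := by
  refine ⟨h.toSpatialEmbedding, h.isTame_carrier, S3.quarterTurn,
    S3.quarterTurn_one_image fun x hx => ?_, S3.quarterTurn_one_image ?_⟩
  · rw [mem_carrier] at hx ⊢
    rcases hx with ⟨v, rfl⟩ | ⟨u, v, huv, hx⟩
    · exact Or.inl ⟨π v, h.vert_map v⟩
    · refine Or.inr ⟨π u, π v, h.adj_map u v huv, ?_⟩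
      rw [vert_map, vert_map]
      exact S3.rotoreflect_mem_geodesicArc hx
  · rintro _ ⟨v, rfl⟩
    exact ⟨π v, h.vert_map v⟩

end IsSymmetricDrawing

theorem SimpleGraph.AchirallyEmbeddable.of_iso {V W : Type*} {G : SimpleGraph V}
    {H : SimpleGraph W} (f : G ≃g H) (h : H.AchirallyEmbeddable) : G.AchirallyEmbeddable := by
  obtain ⟨Γ, ht, ha⟩ := h
  let Γ' : SpatialEmbedding G :=
    { vert := fun v => Γ.vert (f v)
      arc := fun e => Γ.arc (f.mapEdgeSet e)
      vert_injective := Γ.vert_injective.comp f.injective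
      arc_eq_range := fun u v huv => Γ.arc_eq_range (f u) (f v) (f.map_rel_iff.mpr huv)
      vert_mem_arc := by
        intro e w hw
        have := Γ.vert_mem_arc _ _ hw
        obtain ⟨e, he⟩ := e
        induction e using Sym2.ind with
        | _ u v => simpa [SimpleGraph.Iso.mapEdgeSet, SimpleGraph.Hom.mapEdgeSet] using this
      arc_inter_arc := by
        intro e e' hne x hx
        obtain ⟨w, hw⟩ := Γ.arc_inter_arc _ _ (f.mapEdgeSet.injective.ne hne) hx
        exact ⟨f.symm w, by simpa using hw⟩ }
  have hr : Set.range Γ'.vert = Set.range Γ.vert := f.surjective.range_comp Γ.vert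
  have hc : Γ'.carrier = Γ.carrier := by
    unfold SpatialEmbedding.carrier
    rw [hr]
    exact congrArg _ (f.mapEdgeSet.surjective.iUnion_comp Γ.arc)
  refine ⟨Γ', hc ▸ ht, ?_⟩
  unfold SpatialEmbedding.IsAchiral
  rw [hr, hc]
  exact ha

/-! ### Hyperplane sections of the orbit curve -/

section Field

variable {F : Type*} [Field F]

/-- The Laurent polynomial `z² + z⁻² - e₁ z - e₃ z⁻¹ + e₂` with the roots `x`, `y`, `w` and
`(x y w)⁻¹`. -/
theorem laurent_quartic_eq {x y w z : F} (hx : x ≠ 0) (hy : y ≠ 0) (hw : w ≠ 0) (hz : z ≠ 0) :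
    (z ^ 2 + z⁻¹ ^ 2) - (x + y + w + (x * y * w)⁻¹) * z - (x * y * w + x⁻¹ + y⁻¹ + w⁻¹) * z⁻¹ +
      (x * y + x * w + y * w + (x * y)⁻¹ + (x * w)⁻¹ + (y * w)⁻¹) =
    z⁻¹ ^ 2 * ((z - x) * (z - y) * (z - w) * (z - (x * y * w)⁻¹)) := by
  field_simp
  ring

/-- Combining the relations with the coefficients of the Laurent polynomial that vanishes at `x`,
`y`, `w` leaves `a` times its value at `z`, which is nonzero. The points `x`, `y`, `w` may coincide,
so shorter relations can be padded with repeated points. -/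
theorem coeff_eq_zero_of_four {x y w z a b c d : F} (hx : x ≠ 0) (hy : y ≠ 0) (hw : w ≠ 0)
    (hz : z ≠ 0) (hzx : z ≠ x) (hzy : z ≠ y) (hzw : z ≠ w) (hprod : x * y * w * z ≠ 1)
    (h0 : a + b + c + d = 0) (h1 : a * z + b * x + c * y + d * w = 0)
    (h1' : a * z⁻¹ + b * x⁻¹ + c * y⁻¹ + d * w⁻¹ = 0)
    (h2 : a * (z ^ 2 + z⁻¹ ^ 2) + b * (x ^ 2 + x⁻¹ ^ 2) + c * (y ^ 2 + y⁻¹ ^ 2) +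
      d * (w ^ 2 + w⁻¹ ^ 2) = 0) : a = 0 := by
  have ez := laurent_quartic_eq hx hy hw hz
  have ex := laurent_quartic_eq hx hy hw hx
  have ey := laurent_quartic_eq hx hy hw hy
  have ew := laurent_quartic_eq hx hy hw hw
  have key : a * (z⁻¹ ^ 2 * ((z - x) * (z - y) * (z - w) * (z - (x * y * w)⁻¹))) = 0 := by
    linear_combination h2 - (x + y + w + (x * y * w)⁻¹) * h1 -
      (x * y * w + x⁻¹ + y⁻¹ + w⁻¹) * h1' +
      (x * y + x * w + y * w + (x * y)⁻¹ + (x * w)⁻¹ + (y * w)⁻¹) * h0 -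
      a * ez - b * ex - c * ey - d * ew
  have h4 : z ≠ (x * y * w)⁻¹ := fun h => hprod (by
    rw [h, mul_inv_cancel₀ (mul_ne_zero (mul_ne_zero hx hy) hw)])
  simpa [hz, sub_eq_zero, hzx, hzy, hzw, h4, -mul_inv_rev] using key

/-- The same Laurent polynomial, read as a linear form, takes the value `2 * p + q * e₂` on the
fixed circle, where e₂ is its constant coefficient. -/
theorem coeff_axis_eq_zero {x y w a b c d p q : F} (hx : x ≠ 0) (hy : y ≠ 0) (hw : w ≠ 0)
    (h0 : a + b + c + d * q = 0) (h1 : a * x + b * y + c * w = 0)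
    (h1' : a * x⁻¹ + b * y⁻¹ + c * w⁻¹ = 0)
    (h2 : a * (x ^ 2 + x⁻¹ ^ 2) + b * (y ^ 2 + y⁻¹ ^ 2) + c * (w ^ 2 + w⁻¹ ^ 2) +
      d * (2 * p) = 0) :
    d * (2 * p + q * (x * y + x * w + y * w + (x * y)⁻¹ + (x * w)⁻¹ + (y * w)⁻¹)) = 0 := by
  have ex := laurent_quartic_eq hx hy hw hx
  have ey := laurent_quartic_eq hx hy hw hy
  have ew := laurent_quartic_eq hx hy hw hw
  linear_combination h2 - (x + y + w + (x * y * w)⁻¹) * h1 -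
    (x * y * w + x⁻¹ + y⁻¹ + w⁻¹) * h1' +
    (x * y + x * w + y * w + (x * y)⁻¹ + (x * w)⁻¹ + (y * w)⁻¹) * h0 - a * ex - b * ey - c * ew

end Field

/-! ### Vertex positions and their linear relations -/

/-- The position of a vertex in a generic orbit of the rotoreflection, which acts by `z ↦ i z`. -/
noncomputable def orbitVec (z : ℂ) : E4 := !₂[(z ^ 2).re, z.re, z.im, 1]

/-- The position of a vertex on the circle fixed by the square of the rotoreflection. -/
noncomputable def axisVec (p : ℝ × ℝ) : E4 := !₂[p.1, 0, 0, p.2]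

theorem rotoreflect_orbitVec (z : ℂ) :
    E4.rotoreflect (orbitVec z) = orbitVec (Complex.I * z) := by
  ext i
  fin_cases i <;> simp [E4.rotoreflect_apply, orbitVec, mul_pow]

theorem rotoreflect_axisVec (p : ℝ × ℝ) :
    E4.rotoreflect (axisVec p) = axisVec (-p.1, p.2) := by
  ext i
  fin_cases i <;> simp [E4.rotoreflect_apply, axisVec]

theorem smul_axisVec (a : ℝ) (p : ℝ × ℝ) : a • axisVec p = axisVec (a • p) := by
  ext i
  fin_cases i <;> simp [axisVec]

theorem axisVec_add (p q : ℝ × ℝ) : axisVec (p + q) = axisVec p + axisVec q := by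
  ext i
  fin_cases i <;> simp [axisVec]

theorem axisVec_zero : axisVec 0 = 0 := by
  ext i
  fin_cases i <;> simp [axisVec]

theorem axisVec_injective : Function.Injective axisVec := fun p q h =>
  Prod.ext (by simpa [axisVec] using congrArg (fun x : E4 => x 0) h)
    (by simpa [axisVec] using congrArg (fun x : E4 => x 3) h)

theorem orbitVec_ne_zero (z : ℂ) : orbitVec z ≠ 0 := fun h => by
  simpa [orbitVec] using congrArg (fun x : E4 => x 3) h

/-- The four complex equations equivalent to a linear relation between positions. -/
theorem relation_equations {x y w z : ℂ} (hx : ‖x‖ = 1) (hy : ‖y‖ = 1) (hw : ‖w‖ = 1)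
    (hz : ‖z‖ = 1) {a b c d e : ℝ} {p : ℝ × ℝ}
    (h : a • orbitVec x + b • orbitVec y + c • orbitVec w + d • orbitVec z + e • axisVec p = 0) :
    (a + b + c + d + e * p.2 : ℂ) = 0 ∧ (a * x + b * y + c * w + d * z : ℂ) = 0 ∧
    (a * x⁻¹ + b * y⁻¹ + c * w⁻¹ + d * z⁻¹ : ℂ) = 0 ∧
    (a * (x ^ 2 + x⁻¹ ^ 2) + b * (y ^ 2 + y⁻¹ ^ 2) + c * (w ^ 2 + w⁻¹ ^ 2) +
      d * (z ^ 2 + z⁻¹ ^ 2) + e * (2 * p.1) : ℂ) = 0 := by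
  have h0 := congrArg (fun x : E4 => x 0) h
  have h1 := congrArg (fun x : E4 => x 1) h
  have h2 := congrArg (fun x : E4 => x 2) h
  have h3 := congrArg (fun x : E4 => x 3) h
  simp only [orbitVec, axisVec, PiLp.add_apply, PiLp.smul_apply, PiLp.zero_apply, Matrix.cons_val,
    smul_eq_mul, mul_one, mul_zero, add_zero] at h0 h1 h2 h3
  have hinv : ∀ {u : ℂ}, ‖u‖ = 1 → u⁻¹ = (starRingEnd ℂ) u := fun hu => Complex.inv_eq_conj hu
  have hsq : ∀ {u : ℂ}, ‖u‖ = 1 → u ^ 2 + u⁻¹ ^ 2 = 2 * ((u ^ 2).re : ℂ) := fun {u} hu => by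
    rw [hinv hu, ← map_pow, Complex.add_conj]
    push_cast
    ring
  have e1 : (a * x + b * y + c * w + d * z : ℂ) = 0 :=
    Complex.ext (by simpa using h1) (by simpa using h2)
  refine ⟨by exact_mod_cast h3, e1, ?_, ?_⟩
  -- Inversion is conjugation on the unit circle, so this is the conjugate of the preceding
  -- equation.
  · rw [hinv hx, hinv hy, hinv hw, hinv hz]
    simpa using congrArg (starRingEnd ℂ) e1
  · rw [hsq hx, hsq hy, hsq hw, hsq hz]
    have h0' : (a * (x ^ 2).re + b * (y ^ 2).re + c * (w ^ 2).re + d * (z ^ 2).re + e * p.1 : ℂ)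
        = 0 := by exact_mod_cast h0
    linear_combination 2 * h0'

/-! ### Points near fourth roots of unity -/

/-- The points of the unit circle slightly ahead of a fourth root of unity. -/
def NearFourthRoot (z : ℂ) : Prop :=
  ∃ (k : ℕ) (t : ℝ), 0 < t ∧ t < 1 / 10 ∧ z = Complex.I ^ k * Complex.exp (t * Complex.I)

/-- The points of the plane that avoid the intersections of the fixed circle with the hyperplanes
through three points near fourth roots of unity. -/
def Admissible (p : ℝ × ℝ) : Prop :=
  ∀ r : ℝ, 1 / 2 ≤ |r| → |r| ≤ 3 → p.1 + p.2 * r ≠ 0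

theorem Complex.I_pow_mul_exp_parts (k : ℕ) (t : ℝ) :
    (k % 2 = 0 ∧ |(I ^ k * exp (t * I)).re| = |Real.cos t| ∧
      |(I ^ k * exp (t * I)).im| = |Real.sin t|) ∨
    (k % 2 = 1 ∧ |(I ^ k * exp (t * I)).re| = |Real.sin t| ∧
      |(I ^ k * exp (t * I)).im| = |Real.cos t|) := by
  have hre := Complex.exp_ofReal_mul_I_re t
  have him := Complex.exp_ofReal_mul_I_im t
  rcases Nat.even_or_odd' k with ⟨m, rfl | rfl⟩
  · left
    rw [pow_mul, I_sq]
    refine ⟨by omega, ?_⟩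
    rcases neg_one_pow_eq_or ℂ m with h | h <;> simp [h, hre, him]
  · right
    rw [pow_succ, pow_mul, I_sq]
    refine ⟨by omega, ?_⟩
    rcases neg_one_pow_eq_or ℂ m with h | h <;> simp [h, hre, him]

namespace NearFourthRoot

theorem norm_eq {z : ℂ} (h : NearFourthRoot z) : ‖z‖ = 1 := by
  obtain ⟨k, t, -, -, rfl⟩ := h
  simp [Complex.norm_exp_ofReal_mul_I]

theorem ne_zero {z : ℂ} (h : NearFourthRoot z) : z ≠ 0 := by
  rw [← norm_ne_zero_iff, h.norm_eq]
  exact one_ne_zero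

/-- The product is a fourth root of unity times exp(iθ) with 0 < θ < 2/5, and θ is less than a
quarter turn. -/
theorem mul_mul_mul_ne_one {x y w z : ℂ} (hx : NearFourthRoot x) (hy : NearFourthRoot y)
    (hw : NearFourthRoot w) (hz : NearFourthRoot z) : x * y * w * z ≠ 1 := by
  obtain ⟨k, r, hr, hr', rfl⟩ := hx
  obtain ⟨l, s, hs, hs', rfl⟩ := hy
  obtain ⟨m, t, ht, ht', rfl⟩ := hw
  obtain ⟨n, u, hu, hu', rfl⟩ := hz
  intro h
  have h' : Complex.I ^ (k + l + m + n) * Complex.exp ((r + s + t + u : ℝ) * Complex.I) = 1 := by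
    rw [← h]
    push_cast
    simp only [pow_add, add_mul, Complex.exp_add]
    ring
  have h1 := Real.one_sub_sq_div_two_le_cos (x := r + s + t + u)
  have h2 : 0 < Real.sin (r + s + t + u) :=
    Real.sin_pos_of_pos_of_lt_pi (by linarith) (by linarith [Real.pi_gt_three])
  rcases Complex.I_pow_mul_exp_parts (k + l + m + n) (r + s + t + u) with
    ⟨-, -, h3⟩ | ⟨-, -, h3⟩ <;> rw [h', Complex.one_im, abs_zero, eq_comm, abs_eq_zero] at h3
  · exact h2.ne' h3
  · nlinarith

/-- The angle s + t lies in (0, 1/5), so its cosine is at least 1 - (1/5)²/2 = 49/50 and its sine is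
below 1/5. -/
theorem abs_re_mul_re {k l : ℕ} {s t : ℝ} (hs : 0 < s) (hs' : s < 1 / 10) (ht : 0 < t)
    (ht' : t < 1 / 10) :
    ((k + l) % 2 = 0 ∧
      49 / 50 ≤ |(Complex.I ^ k * Complex.exp (s * Complex.I) *
        (Complex.I ^ l * Complex.exp (t * Complex.I))).re|) ∨
    ((k + l) % 2 = 1 ∧
      |(Complex.I ^ k * Complex.exp (s * Complex.I) *
        (Complex.I ^ l * Complex.exp (t * Complex.I))).re| ≤ 1 / 5) := by
  have h' : Complex.I ^ k * Complex.exp (s * Complex.I) *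
      (Complex.I ^ l * Complex.exp (t * Complex.I)) =
      Complex.I ^ (k + l) * Complex.exp ((s + t : ℝ) * Complex.I) := by
    push_cast
    simp only [pow_add, add_mul, Complex.exp_add]
    ring
  rw [h']
  have h1 := Real.one_sub_sq_div_two_le_cos (x := s + t)
  have h2 : 0 < Real.sin (s + t) :=
    Real.sin_pos_of_pos_of_lt_pi (by linarith) (by linarith [Real.pi_gt_three])
  have h3 : Real.sin (s + t) < s + t := Real.sin_lt (by linarith)
  rcases Complex.I_pow_mul_exp_parts (k + l) (s + t) with ⟨hk, h4, -⟩ | ⟨hk, h4, -⟩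
  · refine Or.inl ⟨hk, ?_⟩
    rw [h4]
    exact le_trans (by nlinarith) (le_abs_self _)
  · refine Or.inr ⟨hk, ?_⟩
    rw [h4, abs_of_pos h2]
    linarith

/-- The exponents k + l, k + m, l + m have an even sum, so one or three of them are even. With one,
the sum is at least 49/50 - 2/5 in absolute value; with three, at least 2 · 49/50 - 1. -/
theorem abs_re_add_bounds {x y w : ℂ} (hx : NearFourthRoot x) (hy : NearFourthRoot y)
    (hw : NearFourthRoot w) :
    1 / 2 ≤ |(x * y).re + (x * w).re + (y * w).re| ∧
      |(x * y).re + (x * w).re + (y * w).re| ≤ 3 := by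
  have hle : ∀ {u v : ℂ}, NearFourthRoot u → NearFourthRoot v → |(u * v).re| ≤ 1 :=
    fun {u v} hu hv => by
      simpa [hu.norm_eq, hv.norm_eq] using Complex.abs_re_le_norm (u * v)
  have b1 := abs_le.mp (hle hx hy)
  have b2 := abs_le.mp (hle hx hw)
  have b3 := abs_le.mp (hle hy hw)
  refine ⟨?_, abs_le.mpr ⟨by linarith, by linarith⟩⟩
  obtain ⟨k, r, hr, hr', rfl⟩ := hx
  obtain ⟨l, s, hs, hs', rfl⟩ := hy
  obtain ⟨m, t, ht, ht', rfl⟩ := hw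
  have h1 := abs_re_mul_re (k := k) (l := l) hr hr' hs hs'
  have h2 := abs_re_mul_re (k := k) (l := m) hr hr' ht ht'
  have h3 := abs_re_mul_re (k := l) (l := m) hs hs' ht ht'
  generalize (_ * _ : ℂ).re = A at *
  generalize (_ * (Complex.I ^ m * _) : ℂ).re = B at *
  generalize (_ * _ : ℂ).re = C at *
  rw [le_abs]
  rcases h1 with ⟨k1, h1⟩ | ⟨k1, h1⟩ <;> rcases h2 with ⟨k2, h2⟩ | ⟨k2, h2⟩ <;>
    rcases h3 with ⟨k3, h3⟩ | ⟨k3, h3⟩ <;> first | omega | skip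
  all_goals
    simp only [le_abs, abs_le] at h1 h2 h3
    grind

/-- The coefficient of a point of the fixed circle vanishes in a linear relation with three
vertices in generic orbits. -/
theorem axis_coeff_eq_zero {x y w : ℂ} (hx : NearFourthRoot x) (hy : NearFourthRoot y)
    (hw : NearFourthRoot w) {a b c e : ℝ} {p : ℝ × ℝ} (hp : Admissible p)
    (h : a • orbitVec x + b • orbitVec y + c • orbitVec w + e • axisVec p = 0) : e = 0 := by
  obtain ⟨h0, h1, h1', h2⟩ := relation_equations hx.norm_eq hy.norm_eq hw.norm_eq hw.norm_eq
    (d := 0) (h.symm ▸ by rw [zero_smul, add_zero] :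
      a • orbitVec x + b • orbitVec y + c • orbitVec w + (0 : ℝ) • orbitVec w + e • axisVec p = 0)
  simp only [Complex.ofReal_zero, zero_mul, add_zero] at h0 h1 h1' h2
  have key := coeff_axis_eq_zero hx.ne_zero hy.ne_zero hw.ne_zero h0 h1 h1' h2
  have hre : ∀ {u v : ℂ}, NearFourthRoot u → NearFourthRoot v →
      u * v + (u * v)⁻¹ = 2 * ((u * v).re : ℂ) := fun {u v} hu hv => by
    rw [Complex.inv_eq_conj (by simp [hu.norm_eq, hv.norm_eq]), Complex.add_conj]
    push_cast
    ring
  have key' : (e * (p.1 + p.2 * ((x * y).re + (x * w).re + (y * w).re)) : ℂ) = 0 := by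
    linear_combination key / 2 - e * p.2 / 2 * (hre hx hy + hre hx hw + hre hy hw)
  obtain ⟨hl, hu⟩ := abs_re_add_bounds hx hy hw
  have key'' : e * (p.1 + p.2 * ((x * y).re + (x * w).re + (y * w).re)) = 0 := by
    exact_mod_cast key'
  exact (mul_eq_zero.mp key'').resolve_right (hp _ hl hu)

theorem orbit_coeff_eq_zero_of_four {x y w z : ℂ} (hx : NearFourthRoot x)
    (hy : NearFourthRoot y) (hw : NearFourthRoot w) (hz : NearFourthRoot z) (hxy : x ≠ y)
    (hxw : x ≠ w) (hxz : x ≠ z) {a b c d : ℝ}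
    (h : a • orbitVec x + b • orbitVec y + c • orbitVec w + d • orbitVec z = 0) : a = 0 := by
  obtain ⟨h0, h1, h1', h2⟩ := relation_equations hx.norm_eq hy.norm_eq hw.norm_eq hz.norm_eq
    (e := 0) (p := 0) (by rw [h, zero_smul, add_zero])
  simp only [Complex.ofReal_zero, zero_mul, add_zero] at h0 h2
  exact_mod_cast coeff_eq_zero_of_four hy.ne_zero hw.ne_zero hz.ne_zero hx.ne_zero hxy hxw hxz
    (mul_mul_mul_ne_one hy hw hz hx) h0 h1 h1' h2

theorem orbit_coeff_eq_zero_of_three {x y w : ℂ} (hx : NearFourthRoot x)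
    (hy : NearFourthRoot y) (hw : NearFourthRoot w) (hxy : x ≠ y) (hxw : x ≠ w) {a b c : ℝ}
    (h : a • orbitVec x + b • orbitVec y + c • orbitVec w = 0) : a = 0 :=
  orbit_coeff_eq_zero_of_four hx hy hw hw hxy hxw hxw (d := 0) (by rw [h, zero_smul, add_zero])

end NearFourthRoot

/-- The position on the unit circle of the `k`-th vertex of the orbit of parameter `t`. -/
noncomputable def orbitPoint (t : ℝ) (k : Fin 4) : ℂ :=
  Complex.I ^ (k : ℕ) * Complex.exp (t * Complex.I)

theorem nearFourthRoot_orbitPoint {t : ℝ} (h : 0 < t) (h' : t < 1 / 10) (k : Fin 4) :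
    NearFourthRoot (orbitPoint t k) := ⟨k, t, h, h', rfl⟩

theorem orbitPoint_add_one (t : ℝ) (k : Fin 4) :
    orbitPoint t (k + 1) = Complex.I * orbitPoint t k := by
  fin_cases k <;> simp [orbitPoint, Complex.I_pow_three] <;> ring_nf <;> simp

theorem orbitPoint_add_two (t : ℝ) (k : Fin 4) :
    orbitPoint t (k + 2) = -orbitPoint t k := by
  rw [show k + 2 = k + 1 + 1 by rw [add_assoc]; rfl, orbitPoint_add_one, orbitPoint_add_one,
    ← mul_assoc, Complex.I_mul_I, neg_one_mul]

/-- Small positive angles put the four points of an orbit in the four open quadrants, so signs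
determine the index; then the cosine determines the angle. -/
theorem orbitPoint_injective {s t : ℝ} {k l : Fin 4} (hs : 0 < s) (hs' : s < 1 / 10) (ht : 0 < t)
    (ht' : t < 1 / 10) (h : orbitPoint s k = orbitPoint t l) : s = t ∧ k = l := by
  have hpi := Real.pi_gt_three
  have s1 := Real.sin_pos_of_pos_of_lt_pi hs (by linarith)
  have s2 := Real.sin_pos_of_pos_of_lt_pi ht (by linarith)
  have c1 := Real.cos_pos_of_mem_Ioo (x := s) ⟨by linarith, by linarith⟩
  have c2 := Real.cos_pos_of_mem_Ioo (x := t) ⟨by linarith, by linarith⟩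
  have hre := congrArg Complex.re h
  have him := congrArg Complex.im h
  have hkl : k = l := by
    by_contra hkl
    fin_cases k <;> fin_cases l <;>
      simp [orbitPoint, Complex.exp_ofReal_mul_I_re, Complex.exp_ofReal_mul_I_im,
        Complex.I_pow_three] at hre him hkl <;> linarith
  subst hkl
  refine ⟨?_, rfl⟩
  have he : Complex.exp (s * Complex.I) = Complex.exp (t * Complex.I) :=
    mul_left_cancel₀ (pow_ne_zero _ Complex.I_ne_zero) h
  have hc := congrArg Complex.re he
  rw [Complex.exp_ofReal_mul_I_re, Complex.exp_ofReal_mul_I_re] at hc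
  exact Real.injOn_cos ⟨hs.le, by linarith⟩ ⟨ht.le, by linarith⟩ hc

theorem Admissible.ne_zero {p : ℝ × ℝ} (h : Admissible p) : p ≠ 0 := by
  rintro rfl
  exact h 1 (by norm_num) (by norm_num) (by simp)

theorem coeff_orbit_add_axis_eq_zero {z : ℂ} (hz : z ≠ 0) {a : ℝ} {q : ℝ × ℝ}
    (h : a • orbitVec z + axisVec q = 0) : a = 0 := by
  have h1 := congrArg (fun x : E4 => x 1) h
  have h2 := congrArg (fun x : E4 => x 2) h
  simp only [orbitVec, axisVec, PiLp.add_apply, PiLp.smul_apply, PiLp.zero_apply, Matrix.cons_val,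
    smul_eq_mul, add_zero, mul_eq_zero] at h1 h2
  by_contra ha
  exact hz (Complex.ext (h1.resolve_left ha) (h2.resolve_left ha))

theorem coeff_orbit_two_add_axis {z w : ℂ} {a b : ℝ} {q : ℝ × ℝ}
    (h : a • orbitVec z + b • orbitVec w + axisVec q = 0) : (a * z + b * w : ℂ) = 0 := by
  have h1 := congrArg (fun x : E4 => x 1) h
  have h2 := congrArg (fun x : E4 => x 2) h
  simp only [orbitVec, axisVec, PiLp.add_apply, PiLp.smul_apply, PiLp.zero_apply, Matrix.cons_val,
    smul_eq_mul, add_zero] at h1 h2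
  exact Complex.ext (by simpa using h1) (by simpa using h2)

/-! ### Combining free orbits with a drawing on the fixed circle -/

/-- A drawing of a graph on the fixed circle with great circle arcs as edges; the circle is
regarded as the set of rays in the plane. -/
structure IsCircleDrawing {W : Type*} (H : SimpleGraph W) (p : W → ℝ × ℝ) : Prop where
  admissible : ∀ w, Admissible (p w)
  ray_injective : ∀ u v (a : ℝ), 0 ≤ a → p u = a • p v → u = v
  not_antipodal : ∀ u v, H.Adj u v → ∀ a b : ℝ, 0 ≤ a → 0 ≤ b → a • p u + b • p v = 0 →
    a = 0 ∧ b = 0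
  mem_cone : ∀ u v w, H.Adj u v → ∀ a b : ℝ, 0 ≤ a → 0 ≤ b → a • p u + b • p v = p w →
    w = u ∨ w = v
  cone_inter_cone : ∀ u v w y, H.Adj u v → H.Adj w y → s(u, v) ≠ s(w, y) → ∀ a b c d : ℝ,
    0 ≤ a → 0 ≤ b → 0 ≤ c → 0 ≤ d → a • p u + b • p v = c • p w + d • p y →
    ∃ x, ∃ e : ℝ, 0 ≤ e ∧ a • p u + b • p v = e • p x

section Drawing

variable {O W : Type*} {G : SimpleGraph (O ⊕ W)} {z : O → ℂ} {p : W → ℝ × ℝ}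

/-- The positions of the vertices in generic orbits and on the fixed circle. -/
noncomputable def drawingVec (z : O → ℂ) (p : W → ℝ × ℝ) : O ⊕ W → E4 :=
  Sum.elim (fun u => orbitVec (z u)) (fun w => axisVec (p w))

theorem eq_of_smul_eq_smul_of_norm {z w : ℂ} (hz : ‖z‖ = 1) (hw : ‖w‖ = 1) {a c : ℝ} (ha : 0 ≤ a)
    (hc : 0 ≤ c) (h : (a * z : ℂ) = c * w) : a = c ∧ (a = 0 ∨ z = w) := by
  have h1 : a = c := by
    simpa [hz, hw, abs_of_nonneg ha, abs_of_nonneg hc] using congrArg norm h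
  subst h1
  exact ⟨rfl, by simpa [or_comm] using h⟩

/-- Two edges span four independent vectors if disjoint and three if they share an end. In both
cases an unshared end of the first edge has coefficient zero. -/
theorem cone_inter_orbit_orbit (hz : ∀ u, NearFourthRoot (z u)) (hinj : Function.Injective z)
    {u v w y : O} (huv : u ≠ v) (hwy : w ≠ y) (hne : s(u, v) ≠ s(w, y)) {a b c d : ℝ}
    (h : a • orbitVec (z u) + b • orbitVec (z v) = c • orbitVec (z w) + d • orbitVec (z y)) :
    a = 0 ∨ b = 0 := by
  have h' := sub_eq_zero.mpr h
  have key : ∀ {u v y : O} {a b d : ℝ}, v ≠ u → v ≠ y →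
      a • orbitVec (z u) + b • orbitVec (z v) + d • orbitVec (z y) = 0 → b = 0 := by
    intro u v y a b d h1 h2 h3
    refine NearFourthRoot.orbit_coeff_eq_zero_of_three (hz v) (hz u) (hz y) (hinj.ne h1)
      (hinj.ne h2) (b := a) (c := d) ?_
    rw [← h3]
    abel
  by_cases huw : u = w
  · subst huw
    refine Or.inr (key (a := a - c) (d := -d) huv.symm (fun e => hne (by rw [e])) ?_)
    refine Eq.trans ?_ h'
    module
  by_cases huy : u = y
  · subst huy
    refine Or.inr (key (a := a - d) (d := -c) huv.symm
      (fun e => hne (by rw [e, Sym2.eq_swap])) ?_)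
    refine Eq.trans ?_ h'
    module
  by_cases hvw : v = w
  · subst hvw
    refine Or.inl (key (a := b - c) (d := -d) huv huy ?_)
    refine Eq.trans ?_ h'
    module
  by_cases hvy : v = y
  · subst hvy
    refine Or.inl (key (a := b - d) (d := -c) huv huw ?_)
    refine Eq.trans ?_ h'
    module
  refine Or.inl (NearFourthRoot.orbit_coeff_eq_zero_of_four (hz u) (hz v) (hz w) (hz y)
    (hinj.ne huv) (hinj.ne huw) (hinj.ne huy) (b := b) (c := -c) (d := -d) ?_)
  refine Eq.trans ?_ h'
  module

theorem cone_inter_orbit_mixed (hz : ∀ u, NearFourthRoot (z u)) {u v w : O} {q : ℝ × ℝ}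
    (hq : Admissible q) {a b c d : ℝ}
    (h : a • orbitVec (z u) + b • orbitVec (z v) = c • orbitVec (z w) + d • axisVec q) :
    d = 0 := by
  refine neg_eq_zero.mp (NearFourthRoot.axis_coeff_eq_zero (hz u) (hz v) (hz w) hq
    (a := a) (b := b) (c := -c) ?_)
  refine Eq.trans ?_ (sub_eq_zero.mpr h)
  module

/-- The middle coordinates give a z_u = -b z_v, so only an arc between opposite points of the curve
can reach the fixed circle, and it does so on an inadmissible ray. -/
theorem cone_inter_orbit_axis (hz : ∀ u, NearFourthRoot (z u)) {u v : O} {q : ℝ × ℝ}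
    (hv : z v ≠ -z u ∨ q = 0 ∨ Admissible q) {a b : ℝ} (ha : 0 ≤ a) (hb : 0 ≤ b)
    (h : a • orbitVec (z u) + b • orbitVec (z v) = axisVec q) : a = 0 := by
  rcases hv with hv | rfl | hv
  · have h1 := coeff_orbit_two_add_axis (a := a) (b := b) (z := z u) (w := z v) (q := -q) (by
      have : axisVec (-q) = -axisVec q := by simpa using (smul_axisVec (-1) q).symm
      rw [h, this, add_neg_cancel])
    obtain ⟨-, h2⟩ := eq_of_smul_eq_smul_of_norm (hz u).norm_eq
      (by rw [norm_neg]; exact (hz v).norm_eq) ha hb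
      (by linear_combination h1 : (a * z u : ℂ) = b * -z v)
    exact h2.resolve_right fun e => hv (by rw [e, neg_neg])
  · rw [axisVec_zero] at h
    have h3 := congrArg (fun x : E4 => x 3) h
    simp [orbitVec] at h3
    linarith
  · have := NearFourthRoot.axis_coeff_eq_zero (hz u) (hz v) (hz v) hv
      (a := a) (b := b) (c := 0) (e := -1) (by rw [h]; module)
    norm_num at this

theorem coeff_orbit_of_mixed_axis (hz : ∀ u, NearFourthRoot (z u)) {u : O} {a b : ℝ}
    {q r : ℝ × ℝ} (h : a • orbitVec (z u) + b • axisVec q = axisVec r) : a = 0 := by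
  refine coeff_orbit_add_axis_eq_zero (hz u).ne_zero (q := b • q + (-1 : ℝ) • r) ?_
  rw [axisVec_add, ← smul_axisVec, ← smul_axisVec]
  refine Eq.trans ?_ (sub_eq_zero.mpr h)
  module

/-- The middle coordinates see only orbit vertices: a z_u = c z_w forces `a = 0` or a common orbit
vertex. In the latter case the circle terms agree, so `d = 0` or the edges coincide. -/
theorem cone_inter_mixed_mixed (hz : ∀ u, NearFourthRoot (z u)) (hinj : Function.Injective z)
    (hp : IsCircleDrawing (G.comap Sum.inr) p) {u w : O} {v y : W}
    (hne : s((Sum.inl u : O ⊕ W), Sum.inr v) ≠ s(Sum.inl w, Sum.inr y)) {a b c d : ℝ}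
    (ha : 0 ≤ a) (hb : 0 ≤ b) (hc : 0 ≤ c) (hd : 0 ≤ d)
    (h : a • orbitVec (z u) + b • axisVec (p v) = c • orbitVec (z w) + d • axisVec (p y)) :
    a = 0 ∨ d = 0 := by
  have h1 := coeff_orbit_two_add_axis (a := a) (b := -c) (z := z u) (w := z w)
    (q := b • p v + (-d) • p y) (by
      rw [axisVec_add, ← smul_axisVec, ← smul_axisVec]
      refine Eq.trans ?_ (sub_eq_zero.mpr h)
      module)
  push_cast at h1
  obtain ⟨rfl, h2⟩ := eq_of_smul_eq_smul_of_norm (hz u).norm_eq (hz w).norm_eq ha hc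
    (by linear_combination h1)
  refine h2.imp_right fun e => ?_
  obtain rfl := hinj e
  have h3 : b • p v = d • p y := axisVec_injective (by
    rw [← smul_axisVec, ← smul_axisVec]
    exact add_left_cancel h)
  by_contra hd0
  refine hne ?_
  rw [hp.ray_injective y v (d⁻¹ * b) (by positivity) (by
    rw [mul_smul, h3, smul_smul, inv_mul_cancel₀ hd0, one_smul])]

/-- The alternative `hG` handles the only dangerous crossing: either no edge joins opposite orbit
points, or the arcs on the circle avoid the rays where such edges cross it. -/
theorem cone_inter_cone_drawingVec (hz : ∀ u, NearFourthRoot (z u)) (hinj : Function.Injective z)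
    (hp : IsCircleDrawing (G.comap Sum.inr) p)
    (hG : (∀ u v, G.Adj (Sum.inl u) (Sum.inl v) → z v ≠ -z u) ∨
      ∀ w y, G.Adj (Sum.inr w) (Sum.inr y) → ∀ c d : ℝ, 0 ≤ c → 0 ≤ d →
        c • p w + d • p y = 0 ∨ Admissible (c • p w + d • p y))
    (u v w y : O ⊕ W) (huv : G.Adj u v) (hwy : G.Adj w y) (hne : s(u, v) ≠ s(w, y))
    (a b c d : ℝ) (ha : 0 ≤ a) (hb : 0 ≤ b) (hc : 0 ≤ c) (hd : 0 ≤ d)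
    (h : a • drawingVec z p u + b • drawingVec z p v =
      c • drawingVec z p w + d • drawingVec z p y) :
    ∃ x, ∃ e : ℝ, 0 ≤ e ∧
      a • drawingVec z p u + b • drawingVec z p v = e • drawingVec z p x := by
  -- A vanishing coefficient leaves the common point on the ray of a single vertex.
  have done : (a = 0 ∨ b = 0) ∨ (c = 0 ∨ d = 0) → ∃ x, ∃ e : ℝ, 0 ≤ e ∧
      a • drawingVec z p u + b • drawingVec z p v = e • drawingVec z p x := by
    rintro ((rfl | rfl) | (rfl | rfl))
    · exact ⟨v, b, hb, by simp⟩
    · exact ⟨u, a, ha, by simp⟩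
    · exact ⟨y, d, hd, by rw [h]; simp⟩
    · exact ⟨w, c, hc, by rw [h]; simp⟩
  have haxis : ∀ {w y : W} {c d : ℝ}, c • axisVec (p w) + d • axisVec (p y) =
      axisVec (c • p w + d • p y) := by
    intros
    rw [axisVec_add, smul_axisVec, smul_axisVec]
  have hOA : ∀ {u v : O} {w y : W}, G.Adj (Sum.inl u) (Sum.inl v) → G.Adj (Sum.inr w) (Sum.inr y) →
      ∀ {a b c d : ℝ}, 0 ≤ a → 0 ≤ b → 0 ≤ c → 0 ≤ d →
      a • orbitVec (z u) + b • orbitVec (z v) = c • axisVec (p w) + d • axisVec (p y) →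
      a = 0 := by
    intro u v w y huv hwy a b c d ha hb hc hd h
    rw [haxis] at h
    exact cone_inter_orbit_axis hz
      (hG.imp (fun hG => hG u v huv) fun hG => hG w y hwy c d hc hd) ha hb h
  rcases u with u | u <;> rcases v with v | v <;> rcases w with w | w <;> rcases y with y | y <;>
    simp only [drawingVec, Sum.elim_inl, Sum.elim_inr] at h
  · refine done (Or.inl (cone_inter_orbit_orbit hz hinj (fun e => huv.ne (congrArg Sum.inl e))
      (fun e => hwy.ne (congrArg Sum.inl e)) (fun e => hne ?_) h))
    simpa using congrArg (Sym2.map (Sum.inl : O → O ⊕ W)) e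
  · exact done (Or.inr (Or.inr (cone_inter_orbit_mixed hz (hp.admissible y) h)))
  · rw [add_comm (c • _)] at h
    exact done (Or.inr (Or.inl (cone_inter_orbit_mixed hz (hp.admissible w) h)))
  · exact done (Or.inl (Or.inl (hOA huv hwy ha hb hc hd h)))
  · exact done (Or.inl (Or.inr (cone_inter_orbit_mixed hz (hp.admissible v) h.symm)))
  · exact done ((cone_inter_mixed_mixed hz hinj hp hne ha hb hc hd h).imp Or.inl Or.inr)
  · rw [add_comm (c • _)] at h
    rw [Sym2.eq_swap (a := Sum.inr w)] at hne
    exact done ((cone_inter_mixed_mixed hz hinj hp hne ha hb hd hc h).imp Or.inl Or.inl)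
  · rw [haxis] at h
    exact done (Or.inl (Or.inl (coeff_orbit_of_mixed_axis hz h)))
  · rw [add_comm (a • _)] at h
    exact done (Or.inl (Or.inl (cone_inter_orbit_mixed hz (hp.admissible u) h.symm)))
  · rw [add_comm (a • _)] at h
    rw [Sym2.eq_swap (a := Sum.inr u)] at hne
    exact done ((cone_inter_mixed_mixed hz hinj hp hne hb ha hc hd h).imp Or.inr Or.inr)
  · rw [add_comm (a • _), add_comm (c • _)] at h
    rw [Sym2.eq_swap (a := Sum.inr u), Sym2.eq_swap (a := Sum.inr w)] at hne
    exact done ((cone_inter_mixed_mixed hz hinj hp hne hb ha hd hc h).imp Or.inr Or.inl)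
  · rw [haxis, add_comm (a • _)] at h
    exact done (Or.inl (Or.inr (coeff_orbit_of_mixed_axis hz h)))
  · exact done (Or.inr (Or.inl (hOA hwy huv hc hd ha hb h.symm)))
  · rw [haxis] at h
    exact done (Or.inr (Or.inl (coeff_orbit_of_mixed_axis hz h.symm)))
  · rw [haxis, add_comm (c • _)] at h
    exact done (Or.inr (Or.inr (coeff_orbit_of_mixed_axis hz h.symm)))
  · rw [haxis, haxis] at h
    obtain ⟨x, e, he, hx⟩ := hp.cone_inter_cone u v w y huv hwy
      (fun e => hne (by simpa using congrArg (Sym2.map (Sum.inr : W → O ⊕ W)) e))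
      a b c d ha hb hc hd (axisVec_injective h)
    refine ⟨Sum.inr x, e, he, ?_⟩
    simp only [drawingVec, Sum.elim_inr]
    rw [haxis, hx, smul_axisVec]

theorem isSymmetricDrawing_drawingVec (hz : ∀ u, NearFourthRoot (z u))
    (hinj : Function.Injective z) (hp : IsCircleDrawing (G.comap Sum.inr) p)
    (hG : (∀ u v, G.Adj (Sum.inl u) (Sum.inl v) → z v ≠ -z u) ∨
      ∀ w y, G.Adj (Sum.inr w) (Sum.inr y) → ∀ c d : ℝ, 0 ≤ c → 0 ≤ d →
        c • p w + d • p y = 0 ∨ Admissible (c • p w + d • p y))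
    {ρ : O → O} {σ : W → W} (hρ : ∀ u, z (ρ u) = Complex.I * z u)
    (hσ : ∀ w, p (σ w) = (-(p w).1, (p w).2))
    (hadj : ∀ u v, G.Adj u v → G.Adj (Sum.map ρ σ u) (Sum.map ρ σ v)) :
    IsSymmetricDrawing G (drawingVec z p) (Sum.map ρ σ) where
  ne_zero := by
    rintro (u | w)
    · exact orbitVec_ne_zero _
    · exact fun h => (hp.admissible w).ne_zero (axisVec_injective (h.trans axisVec_zero.symm))
  ray_injective := by
    rintro (u | w) (v | y) a ha h <;> simp only [drawingVec, Sum.elim_inl, Sum.elim_inr] at h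
    · by_contra hne
      have := NearFourthRoot.orbit_coeff_eq_zero_of_three (hz u) (hz v) (hz v) (a := 1)
        (hinj.ne fun e => hne (e ▸ rfl)) (hinj.ne fun e => hne (e ▸ rfl)) (b := -a) (c := 0)
        (by rw [h]; module)
      exact absurd this one_ne_zero
    · have := coeff_orbit_add_axis_eq_zero (hz u).ne_zero (a := 1) (q := (-a) • p y)
        (by rw [h, ← smul_axisVec]; module)
      exact absurd this one_ne_zero
    · have := NearFourthRoot.axis_coeff_eq_zero (hz v) (hz v) (hz v) (hp.admissible w)
        (a := a) (b := 0) (c := 0) (e := -1) (by rw [h]; module)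
      norm_num at this
    · rw [smul_axisVec] at h
      rw [hp.ray_injective w y a ha (axisVec_injective h)]
  not_antipodal := by
    rintro (u | w) (v | y) hadj a b ha hb h <;>
      simp only [drawingVec, Sum.elim_inl, Sum.elim_inr] at h
    · have h3 := congrArg (fun x : E4 => x 3) h
      simp [orbitVec] at h3
      exact ⟨by linarith, by linarith⟩
    · have h0 := coeff_orbit_of_mixed_axis hz (h.trans axisVec_zero.symm)
      rw [h0, zero_smul, zero_add, smul_axisVec, ← axisVec_zero] at h
      exact ⟨h0, (smul_eq_zero.mp (axisVec_injective h)).resolve_right (hp.admissible y).ne_zero⟩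
    · rw [add_comm] at h
      have h0 := coeff_orbit_of_mixed_axis hz (h.trans axisVec_zero.symm)
      rw [h0, zero_smul, zero_add, smul_axisVec, ← axisVec_zero] at h
      exact ⟨(smul_eq_zero.mp (axisVec_injective h)).resolve_right (hp.admissible w).ne_zero, h0⟩
    · rw [smul_axisVec, smul_axisVec, ← axisVec_add, ← axisVec_zero] at h
      exact hp.not_antipodal w y hadj a b ha hb (axisVec_injective h)
  mem_cone := by
    have hmix : ∀ (u : O) (v : W) (w : O ⊕ W) (a b : ℝ), 0 ≤ a → 0 ≤ b →
        a • orbitVec (z u) + b • axisVec (p v) = drawingVec z p w →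
        w = Sum.inl u ∨ w = Sum.inr v := by
      rintro u v (w | w) a b ha hb h <;> simp only [drawingVec, Sum.elim_inl, Sum.elim_inr] at h
      · have hb0 := NearFourthRoot.axis_coeff_eq_zero (hz u) (hz w) (hz w) (hp.admissible v)
          (a := a) (b := -1) (c := 0) (e := b) (by rw [← h]; module)
        subst hb0
        by_contra hne
        rw [not_or] at hne
        have := NearFourthRoot.orbit_coeff_eq_zero_of_three (hz w) (hz u) (hz u) (a := 1)
          (hinj.ne fun e => hne.1 (e ▸ rfl)) (hinj.ne fun e => hne.1 (e ▸ rfl)) (b := -a) (c := 0)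
          (by rw [← h]; module)
        exact absurd this one_ne_zero
      · have ha0 := coeff_orbit_of_mixed_axis hz h
        rw [ha0, zero_smul, zero_add, smul_axisVec] at h
        rw [hp.ray_injective w v b hb (axisVec_injective h).symm]
        exact Or.inr rfl
    rintro (u | u) (v | v) w hadj a b ha hb h
    · simp only [drawingVec, Sum.elim_inl] at h
      rcases w with w | w <;> simp only [Sum.elim_inl, Sum.elim_inr] at h
      · by_contra hne
        rw [not_or] at hne
        have := NearFourthRoot.orbit_coeff_eq_zero_of_three (hz w) (hz u) (hz v) (a := -1)
          (hinj.ne fun e => hne.1 (e ▸ rfl)) (hinj.ne fun e => hne.2 (e ▸ rfl)) (b := a) (c := b)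
          (by rw [← h]; module)
        norm_num at this
      · have := NearFourthRoot.axis_coeff_eq_zero (hz u) (hz v) (hz v) (hp.admissible w)
          (a := a) (b := b) (c := 0) (e := -1) (by rw [← h]; module)
        norm_num at this
    · exact hmix u v w a b ha hb h
    · exact (hmix v u w b a hb ha ((add_comm _ _).trans h)).symm
    · simp only [drawingVec, Sum.elim_inr] at h
      rw [smul_axisVec, smul_axisVec, ← axisVec_add] at h
      rcases w with w | w <;> simp only [Sum.elim_inl, Sum.elim_inr] at h
      · have := coeff_orbit_of_mixed_axis hz (u := w) (a := 1) (b := 0) (q := 0)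
          (r := a • p u + b • p v) (by rw [h]; module)
        exact absurd this one_ne_zero
      · rcases hp.mem_cone u v w hadj a b ha hb (axisVec_injective h) with rfl | rfl
        · exact Or.inl rfl
        · exact Or.inr rfl
  cone_inter_cone := cone_inter_cone_drawingVec hz hinj hp hG
  adj_map := hadj
  apply_map := by
    rintro (u | w)
    · simp [drawingVec, hρ, rotoreflect_orbitVec]
    · simp [drawingVec, hσ, rotoreflect_axisVec]

end Drawing

theorem exists_orbit_parameters (J : Type*) [Finite J] :
    ∃ t : J → ℝ, Function.Injective t ∧ ∀ j, 0 < t j ∧ t j < 1 / 10 := by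
  cases nonempty_fintype J
  -- The offset 11 keeps all parameters below 1/10.
  refine ⟨fun j => 1 / ((Fintype.equivFin J j : ℕ) + 11), fun i j h => ?_, fun j => ⟨?_, ?_⟩⟩
  · have h' : ((Fintype.equivFin J i : ℕ) : ℝ) = (Fintype.equivFin J j : ℕ) := by
      simpa using h
    exact (Fintype.equivFin J).injective (Fin.ext (by exact_mod_cast h'))
  · positivity
  · rw [div_lt_div_iff₀ (by positivity) (by norm_num)]
    have : (0 : ℝ) ≤ (Fintype.equivFin J j : ℕ) := by positivity
    linarith

/-- A graph whose vertices form free orbits of a symmetry of order four, together with a few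
vertices that can be drawn on the fixed circle, is achirally embeddable. -/
theorem achirallyEmbeddable_of_orbits {J W : Type*} [Finite J] [Finite W]
    {G : SimpleGraph ((J × Fin 4) ⊕ W)} {p : W → ℝ × ℝ} {σ : W → W}
    (hp : IsCircleDrawing (G.comap Sum.inr) p)
    (hG : (∀ j k, ¬ G.Adj (Sum.inl (j, k)) (Sum.inl (j, k + 2))) ∨
      ∀ w y, G.Adj (Sum.inr w) (Sum.inr y) → ∀ c d : ℝ, 0 ≤ c → 0 ≤ d →
        c • p w + d • p y = 0 ∨ Admissible (c • p w + d • p y))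
    (hσ : ∀ w, p (σ w) = (-(p w).1, (p w).2))
    (hadj : ∀ u v, G.Adj u v →
      G.Adj (Sum.map (Prod.map id (· + 1)) σ u) (Sum.map (Prod.map id (· + 1)) σ v)) :
    G.AchirallyEmbeddable := by
  obtain ⟨t, ht, hpos⟩ := exists_orbit_parameters J
  refine (isSymmetricDrawing_drawingVec (z := fun x : J × Fin 4 => orbitPoint (t x.1) x.2)
    (fun x => nearFourthRoot_orbitPoint (hpos x.1).1 (hpos x.1).2 x.2) ?_ hp (hG.imp_left ?_)
    (fun x => orbitPoint_add_one _ _) hσ hadj).achirallyEmbeddable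
  · rintro ⟨i, k⟩ ⟨j, l⟩ h
    obtain ⟨h1, h2⟩ := orbitPoint_injective (hpos i).1 (hpos i).2 (hpos j).1 (hpos j).2 h
    exact Prod.ext (ht h1) h2
  · rintro hG ⟨i, k⟩ ⟨j, l⟩ hadj h
    rw [← orbitPoint_add_two] at h
    obtain ⟨h1, h2⟩ := orbitPoint_injective (hpos j).1 (hpos j).2 (hpos i).1 (hpos i).2 h
    obtain rfl := ht h1
    obtain rfl : l = k + 2 := h2
    exact hG j k hadj

/-! ### Complete multipartite graphs as pullbacks of complete graphs -/

/-- In this form joins and copies act on the part labels alone, and an isomorphism only requires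
matching fibre sizes. -/
theorem completeMultipartite_eq_comap {k : ℕ} (m : Fin k → ℕ) :
    completeMultipartite m = (⊤ : SimpleGraph (Fin k)).comap Sigma.fst := by
  ext x y
  simp

theorem SimpleGraph.comap_top_join {V W K L : Type*} (f : V → K) (g : W → L) :
    ((⊤ : SimpleGraph K).comap f).join ((⊤ : SimpleGraph L).comap g) =
      (⊤ : SimpleGraph (K ⊕ L)).comap (Sum.map f g) := by
  ext x y
  rcases x with x | x <;> rcases y with y | y <;> simp [SimpleGraph.join]

theorem SimpleGraph.joinCopies_comap_top {V K : Type*} (n : ℕ) (f : V → K) :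
    ((⊤ : SimpleGraph K).comap f).joinCopies n =
      (⊤ : SimpleGraph (Fin n × K)).comap (Prod.map id f) := by
  ext x y
  simp [SimpleGraph.joinCopies, Prod.ext_iff, imp_iff_not_or]

theorem SimpleGraph.comap_top_comp {V K L : Type*} (f : V → K) {g : K → L}
    (hg : Function.Injective g) :
    (⊤ : SimpleGraph L).comap (g ∘ f) = (⊤ : SimpleGraph K).comap f := by
  ext x y
  simp [hg.eq_iff]

/-- Complete multipartite graphs with parts of the same sizes are isomorphic. -/
theorem SimpleGraph.nonempty_iso_comap_top {V W K : Type*} [Fintype V] [Fintype W] [DecidableEq K]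
    (f : V → K) (g : W → K)
    (h : ∀ κ, (∑ x, if f x = κ then 1 else 0) = ∑ y, if g y = κ then 1 else 0) :
    Nonempty ((⊤ : SimpleGraph K).comap f ≃g (⊤ : SimpleGraph K).comap g) := by
  have e : ∀ κ, Nonempty ({x // f x = κ} ≃ {y // g y = κ}) := fun κ => by
    rw [← Fintype.card_eq, Fintype.card_subtype, Fintype.card_subtype, Finset.card_filter,
      Finset.card_filter]
    exact h κ
  let E : V ≃ W := (Equiv.sigmaFiberEquiv f).symm.trans
    ((Equiv.sigmaCongrRight fun κ => (e κ).some).trans (Equiv.sigmaFiberEquiv g))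
  have hE : ∀ x, g (E x) = f x := fun x => ((e (f x)).some ⟨x, rfl⟩).2
  exact ⟨⟨E, by simp [hE]⟩⟩

/-! ### Distributing the vertices into orbits -/

section Model

variable {k₁ k₂ k₃ : ℕ}

/-- The partite sets of `4G₁ + 2G₂ + G₃ + K_{q₁,q₂,q₃}`. -/
abbrev PartIndex (k₁ k₂ k₃ : ℕ) : Type :=
  (((Fin 4 × Fin k₁) ⊕ (Fin 2 × Fin k₂)) ⊕ Fin k₃) ⊕ Fin 3

/-- The free orbits of the symmetry of order four. -/
abbrev OrbitIndex (a : Fin k₁ → ℕ) (b : Fin k₂ → ℕ) (c : Fin k₃ → ℕ) (m : Fin 3 → ℕ) : Type :=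
  (((Σ i, Fin (a i)) ⊕ (Σ i, Fin (b i))) ⊕ (Σ i, Fin (c i))) ⊕ (Σ i, Fin (m i))

/-- The parity of an element of `ℤ/4ℤ`. -/
def parity (k : Fin 4) : Fin 2 := ⟨k % 2, Nat.mod_lt _ two_pos⟩

theorem parity_add_one (k : Fin 4) : parity (k + 1) = parity k + 1 := by
  revert k; decide

theorem parity_add_two (k : Fin 4) : parity (k + 2) = parity k := by
  revert k; decide

/-- The partite set that contains the `k`-th vertex of an orbit. -/
def orbitPart {a : Fin k₁ → ℕ} {b : Fin k₂ → ℕ} {c : Fin k₃ → ℕ} {m : Fin 3 → ℕ}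
    (τ : Equiv.Perm (Fin 3)) : OrbitIndex a b c m × Fin 4 → PartIndex k₁ k₂ k₃
  | (Sum.inl (Sum.inl (Sum.inl x)), k) => Sum.inl (Sum.inl (Sum.inl (k, x.1)))
  | (Sum.inl (Sum.inl (Sum.inr x)), k) => Sum.inl (Sum.inl (Sum.inr (parity k, x.1)))
  | (Sum.inl (Sum.inr x), _) => Sum.inl (Sum.inr x.1)
  | (Sum.inr x, k) => Sum.inr ((τ ^ (k : ℕ)) x.1)

/-- The action of the symmetry on the partite sets. -/
def partShift (τ : Equiv.Perm (Fin 3)) : PartIndex k₁ k₂ k₃ → PartIndex k₁ k₂ k₃ :=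
  Sum.map (Sum.map (Sum.map (Prod.map (· + 1) id) (Prod.map (· + 1) id)) id) τ

theorem partShift_injective (τ : Equiv.Perm (Fin 3)) :
    Function.Injective (partShift τ : PartIndex k₁ k₂ k₃ → PartIndex k₁ k₂ k₃) :=
  Function.Injective.sumMap
    (Function.Injective.sumMap
      (Function.Injective.sumMap (Function.Injective.prodMap (add_left_injective 1)
        Function.injective_id) (Function.Injective.prodMap (add_left_injective 1)
        Function.injective_id)) Function.injective_id) τ.injective

theorem pow_val_add_one {τ : Equiv.Perm (Fin 3)} (hτ : τ * τ = 1) (k : Fin 4) (i : Fin 3) :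
    (τ ^ ((k + 1 : Fin 4) : ℕ)) i = τ ((τ ^ (k : ℕ)) i) := by
  revert τ k i; decide

/-- Hence opposite vertices of an orbit in K_{q₁,q₂,q₃} share a partite set and are not adjacent. -/
theorem pow_val_add_two {τ : Equiv.Perm (Fin 3)} (hτ : τ * τ = 1) (k : Fin 4) (i : Fin 3) :
    (τ ^ ((k + 2 : Fin 4) : ℕ)) i = (τ ^ (k : ℕ)) i := by
  revert τ k i; decide

theorem orbitPart_add_one {a : Fin k₁ → ℕ} {b : Fin k₂ → ℕ} {c : Fin k₃ → ℕ} {m : Fin 3 → ℕ}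
    {τ : Equiv.Perm (Fin 3)} (hτ : τ * τ = 1) (x : OrbitIndex a b c m × Fin 4) :
    orbitPart τ (Prod.map id (· + 1) x) = partShift τ (orbitPart τ x) := by
  obtain ⟨((x | x) | x) | x, k⟩ := x <;>
    simp [orbitPart, partShift, parity_add_one, pow_val_add_one hτ]

theorem sum_sigma_fst {k : ℕ} (m : Fin k → ℕ) (f : Fin k → ℕ) :
    ∑ x : Σ i, Fin (m i), f x.1 = ∑ i, m i * f i := by
  simp [Fintype.sum_sigma]

/-- Both sides count one partite set. An orbit of 2G₂ has two vertices in each copy, hence `b'` is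
half of `b`; an orbit of G₃ lies in one part, hence `c'` is a quarter of `c`; `hq` is the count for
K_{q₁,q₂,q₃}. -/
theorem sum_orbitPart {a : Fin k₁ → ℕ} {b : Fin k₂ → ℕ} {c : Fin k₃ → ℕ} {m q : Fin 3 → ℕ}
    {b' : Fin k₂ → ℕ} {c' : Fin k₃ → ℕ} (hb : ∀ i, b i = 2 * b' i) (hc : ∀ i, c i = 4 * c' i)
    {τ : Equiv.Perm (Fin 3)} {W : Type*} [Fintype W] {ω : W → Fin 3} {σ : Equiv.Perm (Fin 3)}
    (hq : ∀ i, q (σ i) = (∑ w, if ω w = i then 1 else 0) +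
      ∑ r, m r * ∑ k : Fin 4, if (τ ^ (k : ℕ)) r = i then 1 else 0)
    (κ : PartIndex k₁ k₂ k₃) :
    (∑ x, if Sum.map (Sum.map (Sum.map (Prod.map id (Sigma.fst : (Σ i, Fin (a i)) → Fin k₁))
      (Prod.map id (Sigma.fst : (Σ i, Fin (b i)) → Fin k₂)))
      (Sigma.fst : (Σ i, Fin (c i)) → Fin k₃))
      (σ.symm ∘ (Sigma.fst : (Σ i, Fin (q i)) → Fin 3)) x = κ then 1 else 0) =
    ∑ x, if Sum.elim (orbitPart (a := a) (b := b') (c := c') (m := m) τ)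
      (fun w : W => Sum.inr (ω w)) x = κ then 1 else 0 := by
  have hpar : ∀ (e : Fin 2) (n : ℕ), (∑ k : Fin 4, if parity k = e then n else 0) = 2 * n := by
    intro e n
    rw [← Finset.sum_filter, Finset.sum_const, smul_eq_mul]
    congr 1
    revert e
    decide
  rcases κ with ((⟨e, i⟩ | ⟨e, i⟩) | i) | i <;>
    simp only [Fintype.sum_sum_type, Fintype.sum_prod_type, Sum.map_inl, Sum.map_inr, Sum.elim_inl,
      Sum.elim_inr, orbitPart, Prod.map_apply, id_eq, Function.comp_apply, reduceCtorEq,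
      Sum.inl.injEq, Sum.inr.injEq, Prod.mk.injEq, if_false, Finset.sum_const_zero, add_zero,
      zero_add]
  · rw [Finset.sum_comm]
  · simp only [ite_and, hpar]
    rw [Finset.sum_comm]
    simp only [Finset.sum_ite_eq', Finset.mem_univ, if_true]
    refine (sum_sigma_fst b fun j => if j = i then 1 else 0).trans
      (Eq.trans ?_ (sum_sigma_fst b' fun j => 2 * if j = i then 1 else 0).symm)
    simp [hb, mul_comm]
  · refine (sum_sigma_fst c fun j => if j = i then 1 else 0).trans
      (Eq.trans ?_ (sum_sigma_fst c' fun j => ∑ _k : Fin 4, if j = i then 1 else 0).symm)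
    simp [hc, mul_comm]
  · refine (sum_sigma_fst q fun j => if σ.symm j = i then 1 else 0).trans
      (Eq.trans ?_ (congrArg (· + _) (sum_sigma_fst m fun j =>
        ∑ k : Fin 4, if (τ ^ (k : ℕ)) j = i then 1 else 0).symm))
    rw [add_comm, ← hq]
    simp [Equiv.symm_apply_eq]

/-- The graph `4G₁ + 2G₂ + G₃ + K_{q₁,q₂,q₃}` is achirally embeddable if, after the removal of
free orbits, the remaining vertices of `K_{q₁,q₂,q₃}` can be drawn on the fixed circle. -/
theorem achirallyEmbeddable_of_circleDrawing {V : Type*} {γ : SimpleGraph V}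
    {a : Fin k₁ → ℕ} {b : Fin k₂ → ℕ} {c : Fin k₃ → ℕ} {q : Fin 3 → ℕ}
    (hγ : Nonempty (γ ≃g
      ((((completeMultipartite a).joinCopies 4).join ((completeMultipartite b).joinCopies 2)).join
        (completeMultipartite c)).join (completeMultipartite q)))
    (hb : ∀ i, Even (b i)) (hc : ∀ i, 4 ∣ c i) (σ τ : Equiv.Perm (Fin 3)) (hτ : τ * τ = 1)
    {n : ℕ} (ω : Fin n → Fin 3) (m : Fin 3 → ℕ)
    (hq : ∀ i, q (σ i) = (∑ w, if ω w = i then 1 else 0) +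
      ∑ r, m r * ∑ k : Fin 4, if (τ ^ (k : ℕ)) r = i then 1 else 0)
    (p : Fin n → ℝ × ℝ) (hp : IsCircleDrawing ((⊤ : SimpleGraph (Fin 3)).comap ω) p)
    (ι : Fin n → Fin n) (hι : ∀ w, p (ι w) = (-(p w).1, (p w).2)) (hω : ∀ w, ω (ι w) = τ (ω w))
    (ha : (∀ i, a i = 0) ∨ ∀ w y, ω w ≠ ω y → ∀ c d : ℝ, 0 ≤ c → 0 ≤ d →
      c • p w + d • p y = 0 ∨ Admissible (c • p w + d • p y)) :
    γ.AchirallyEmbeddable := by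
  choose b' hb' using fun i => (hb i).two_dvd
  choose c' hc' using hc
  obtain ⟨f⟩ := hγ
  let part : (OrbitIndex a b' c' m × Fin 4) ⊕ Fin n → PartIndex k₁ k₂ k₃ :=
    Sum.elim (orbitPart τ) fun w => Sum.inr (ω w)
  obtain ⟨g⟩ := SimpleGraph.nonempty_iso_comap_top _ part
    (sum_orbitPart (a := a) (b := b) (c := c) hb' hc' hq)
  rw [← SimpleGraph.comap_top_join, ← SimpleGraph.comap_top_join, ← SimpleGraph.comap_top_join,
    ← SimpleGraph.joinCopies_comap_top, ← SimpleGraph.joinCopies_comap_top,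
    SimpleGraph.comap_top_comp _ σ.symm.injective, ← completeMultipartite_eq_comap,
    ← completeMultipartite_eq_comap, ← completeMultipartite_eq_comap,
    ← completeMultipartite_eq_comap] at g
  refine SimpleGraph.AchirallyEmbeddable.of_iso (f.trans g)
    (achirallyEmbeddable_of_orbits (p := p) (σ := ι) ?_ ?_ hι ?_)
  · convert hp using 1
    ext w y
    simp [part]
  -- Opposite vertices are adjacent only in orbits of 4G₁, and there are none when every `a i` is
  -- zero.
  · refine ha.imp (fun ha j k => ?_) fun h w y hwy => h w y (by simpa [part] using hwy)
    rcases j with ((⟨i, x⟩ | x) | x) | x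
    · exact (Fin.cast (ha i) x).elim0
    all_goals simp [part, orbitPart, parity_add_two, pow_val_add_two hτ]
  · have hpart : ∀ u, part (Sum.map (Prod.map id (· + 1)) ι u) = partShift τ (part u) := by
      rintro (u | w)
      · exact orbitPart_add_one hτ u
      · simp [part, hω, partShift]
    intro u v huv
    simpa [hpart, (partShift_injective τ).eq_iff] using huv

end Model

/-! ### Drawings of small graphs on the fixed circle -/

/-- An inadmissible nonzero point has |p₁| / |p₂| in [1/2, 3]; this criterion and the next one cover
the two sides of that interval. -/
theorem admissible_of_two_mul_abs_lt {p : ℝ × ℝ} (h : 2 * |p.1| < |p.2|) : Admissible p := by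
  intro r hr _ h0
  have h1 : |p.1| = |p.2| * |r| := by
    rw [← abs_mul, show p.1 = -(p.2 * r) by linarith, abs_neg]
  nlinarith [abs_nonneg p.1, abs_nonneg p.2]

theorem admissible_of_three_mul_abs_lt {p : ℝ × ℝ} (h : 3 * |p.2| < |p.1|) : Admissible p := by
  intro r _ hr h0
  have h1 : |p.1| = |p.2| * |r| := by
    rw [← abs_mul, show p.1 = -(p.2 * r) by linarith, abs_neg]
  nlinarith [abs_nonneg p.1, abs_nonneg p.2]

/-- Only relations with positive coefficients have to be excluded in a drawing on the circle. -/
theorem IsCircleDrawing.of_pos {W : Type*} {H : SimpleGraph W} {p : W → ℝ × ℝ}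
    (admissible : ∀ w, Admissible (p w))
    (ray_injective : ∀ u v (a : ℝ), u ≠ v → 0 < a → p u ≠ a • p v)
    (not_antipodal : ∀ u v, H.Adj u v → ∀ a b : ℝ, 0 < a → 0 < b → a • p u + b • p v ≠ 0)
    (mem_cone : ∀ u v w, H.Adj u v → w ≠ u → w ≠ v → ∀ a b : ℝ, 0 < a → 0 < b →
      a • p u + b • p v ≠ p w)
    (cone_inter_cone : ∀ u v w y, H.Adj u v → H.Adj w y → s(u, v) ≠ s(w, y) → ∀ a b c d : ℝ,
      0 < a → 0 < b → 0 < c → 0 < d → a • p u + b • p v ≠ c • p w + d • p y) :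
    IsCircleDrawing H p := by
  have hray : ∀ u v (a : ℝ), 0 ≤ a → p u = a • p v → u = v := by
    intro u v a ha h
    by_contra huv
    rcases ha.eq_or_lt with rfl | ha
    · exact (admissible u).ne_zero (by rw [h, zero_smul])
    · exact ray_injective u v a huv ha h
  refine ⟨admissible, hray, ?_, ?_, ?_⟩
  · intro u v huv a b ha hb h
    rcases ha.eq_or_lt with rfl | ha
    · simpa [(admissible v).ne_zero] using h
    rcases hb.eq_or_lt with rfl | hb
    · simpa [(admissible u).ne_zero] using h
    exact absurd h (not_antipodal u v huv a b ha hb)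
  · intro u v w huv a b ha hb h
    rcases ha.eq_or_lt with rfl | ha
    · exact Or.inr (hray w v b hb (by rw [← h]; simp))
    rcases hb.eq_or_lt with rfl | hb
    · exact Or.inl (hray w u a ha.le (by rw [← h]; simp))
    by_contra hw
    rw [not_or] at hw
    exact mem_cone u v w huv hw.1 hw.2 a b ha hb h
  · intro u v w y huv hwy hne a b c d ha hb hc hd h
    rcases ha.eq_or_lt with rfl | ha
    · exact ⟨v, b, hb, by simp⟩
    rcases hb.eq_or_lt with rfl | hb
    · exact ⟨u, a, ha.le, by simp⟩
    rcases hc.eq_or_lt with rfl | hc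
    · exact ⟨y, d, hd, by rw [h]; simp⟩
    rcases hd.eq_or_lt with rfl | hd
    · exact ⟨w, c, hc.le, by rw [h]; simp⟩
    exact absurd h (cone_inter_cone u v w y huv hwy hne a b c d ha hb hc hd)

/-- Equally spaced points near a fixed point of the symmetry of the circle. -/
noncomputable def nearPole (n : ℕ) (l : Fin n) : ℝ × ℝ := ((2 * l - (n - 1)) / 10, 1)

theorem nearPole_rev {n : ℕ} (l : Fin n) :
    nearPole n l.rev = (-(nearPole n l).1, (nearPole n l).2) := by
  have : ((l.rev : ℕ) : ℝ) = n - (l + 1) := by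
    rw [Fin.val_rev, Nat.cast_sub l.2]
    push_cast
    ring
  simp only [nearPole, this, Prod.mk.injEq, and_true]
  ring

theorem abs_nearPole_fst_le {n : ℕ} (hn : n ≤ 3) (l : Fin n) :
    |(nearPole n l).1| ≤ 1 / 5 := by
  interval_cases n
  · exact l.elim0
  all_goals fin_cases l <;> norm_num [nearPole, abs_le]

/-- The condition |p₁| ≤ p₂/5 holds at each point and survives nonnegative combinations, so whole
arcs avoid the inadmissible rays. -/
theorem nearPole_cone {n : ℕ} (hn : n ≤ 3) (w y : Fin n) {c d : ℝ} (hc : 0 ≤ c) (hd : 0 ≤ d) :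
    c • nearPole n w + d • nearPole n y = 0 ∨
      Admissible (c • nearPole n w + d • nearPole n y) := by
  rcases (add_nonneg hc hd).eq_or_lt with h | h
  · left
    rw [show c = 0 by linarith, show d = 0 by linarith]
    simp
  · right
    apply admissible_of_two_mul_abs_lt
    have h1 := abs_le.mp (abs_nearPole_fst_le hn w)
    have h2 := abs_le.mp (abs_nearPole_fst_le hn y)
    have h3 : |(c • nearPole n w + d • nearPole n y).1| ≤ 1 / 5 * (c + d) := by
      rw [abs_le]
      constructor <;> simp only [Prod.fst_add, Prod.smul_fst, smul_eq_mul] <;> nlinarith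
    have h4 : (c • nearPole n w + d • nearPole n y).2 = c + d := by simp [nearPole]
    rw [h4, abs_of_pos h]
    linarith

theorem admissible_nearPole {n : ℕ} (hn : n ≤ 3) (w : Fin n) : Admissible (nearPole n w) := by
  apply admissible_of_two_mul_abs_lt
  have := abs_nearPole_fst_le hn w
  simp only [nearPole, abs_one] at this ⊢
  linarith

theorem nearPole_ray_injective {n : ℕ} (u v : Fin n) (a : ℝ) (huv : u ≠ v) :
    nearPole n u ≠ a • nearPole n v := by
  intro h
  have h2 := congrArg Prod.snd h
  have h1 := congrArg Prod.fst h
  simp only [nearPole, Prod.smul_mk, smul_eq_mul, mul_one] at h1 h2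
  rw [← h2] at h1
  have h3 : ((u : ℕ) : ℝ) = (v : ℕ) := by linarith
  exact huv (Fin.ext (by exact_mod_cast h3))

/-- A weighted mean of consecutive indices lies strictly between them, so its integer part
identifies the edge; distinct edges are intervals with disjoint interiors. -/
theorem exists_floor_of_neighbours {n : ℕ} {u v : Fin n} (h : (u : ℕ) = v + 1 ∨ (v : ℕ) = u + 1)
    {a b : ℝ} (ha : 0 < a) (hb : 0 < b) :
    ∃ i : ℕ, (((u : ℕ) = i ∧ (v : ℕ) = i + 1) ∨ ((v : ℕ) = i ∧ (u : ℕ) = i + 1)) ∧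
      (a + b) * i < a * (u : ℕ) + b * (v : ℕ) ∧
      a * (u : ℕ) + b * (v : ℕ) < (a + b) * (i + 1 : ℕ) := by
  rcases h with h | h
  · refine ⟨v, Or.inr ⟨rfl, h⟩, ?_⟩
    rw [h]
    push_cast
    constructor <;> linarith
  · refine ⟨u, Or.inl ⟨rfl, h⟩, ?_⟩
    rw [h]
    push_cast
    constructor <;> linarith

/-- Points near a pole, with edges between neighbours only. -/
theorem isCircleDrawing_nearPole {n : ℕ} (hn : n ≤ 3) {H : SimpleGraph (Fin n)}
    (hH : ∀ u v, H.Adj u v → (u : ℕ) = v + 1 ∨ (v : ℕ) = u + 1) :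
    IsCircleDrawing H (nearPole n) := by
  refine .of_pos (admissible_nearPole hn) (fun u v a huv _ => nearPole_ray_injective u v a huv)
    ?_ ?_ ?_
  · intro u v _ a b ha hb h
    have h2 := congrArg Prod.snd h
    simp [nearPole] at h2
    linarith
  · intro u v w huv _ _ a b ha hb h
    have h1 := congrArg Prod.fst h
    have h2 := congrArg Prod.snd h
    simp only [nearPole, Prod.smul_mk, smul_eq_mul, Prod.mk_add_mk, mul_one] at h1 h2
    obtain ⟨i, -, hl, hr⟩ := exists_floor_of_neighbours (hH u v huv) ha hb
    -- All second coordinates are 1, so `h2` compares coefficient sums and removes the centring term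
    -- from `h1`.
    have h3 : a * (u : ℕ) + b * (v : ℕ) = (w : ℕ) := by
      linear_combination 5 * h1 + (n - 1) / 2 * h2
    rw [h2, one_mul, h3] at hl hr
    have hl' : i < (w : ℕ) := by exact_mod_cast hl
    have hr' : (w : ℕ) < i + 1 := by exact_mod_cast hr
    omega
  · intro u v w y huv hwy hne a b c d ha hb hc hd h
    have h1 := congrArg Prod.fst h
    have h2 := congrArg Prod.snd h
    simp only [nearPole, Prod.smul_mk, smul_eq_mul, Prod.mk_add_mk, mul_one] at h1 h2
    obtain ⟨i, hi, hl, hr⟩ := exists_floor_of_neighbours (hH u v huv) ha hb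
    obtain ⟨k, hk, hl', hr'⟩ := exists_floor_of_neighbours (hH w y hwy) hc hd
    have h3 : a * (u : ℕ) + b * (v : ℕ) = c * (w : ℕ) + d * (y : ℕ) := by
      linear_combination 5 * h1 + (n - 1) / 2 * h2
    have hpos : 0 < c + d := by positivity
    rw [h3, h2] at hl hr
    have hik : i < k + 1 := by exact_mod_cast lt_of_mul_lt_mul_left (hl.trans hr') hpos.le
    have hki : k < i + 1 := by exact_mod_cast lt_of_mul_lt_mul_left (hl'.trans hr) hpos.le
    obtain rfl : i = k := by omega
    refine hne (Sym2.eq_iff.mpr ?_)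
    simp only [Fin.ext_iff]
    omega

/-- The triangle on the fixed circle. -/
noncomputable def trianglePoint : Fin 3 → ℝ × ℝ := ![(0, 1), (4, -1), (-4, -1)]

/-- The vertices are admissible since 4 > 3, but the three arcs cover the circle, including
inadmissible rays. This drawing therefore serves only when G₁ is empty. -/
theorem isCircleDrawing_triangle (H : SimpleGraph (Fin 3)) : IsCircleDrawing H trianglePoint := by
  refine .of_pos ?_ ?_ ?_ ?_ ?_
  · intro w
    fin_cases w
    · exact admissible_of_two_mul_abs_lt (by norm_num [trianglePoint])
    · exact admissible_of_three_mul_abs_lt (by norm_num [trianglePoint])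
    · exact admissible_of_three_mul_abs_lt (by norm_num [trianglePoint])
  · intro u v a huv ha h
    fin_cases u <;> fin_cases v <;> simp [trianglePoint] at h huv <;> linarith
  · intro u v huv a b ha hb h
    have huv := huv.ne
    fin_cases u <;> fin_cases v <;> simp [trianglePoint] at h huv <;> linarith
  · intro u v w huv hwu hwv a b ha hb h
    have huv := huv.ne
    fin_cases u <;> fin_cases v <;> simp at huv <;> fin_cases w <;>
      simp [trianglePoint] at h hwu hwv <;> linarith
  · intro u v w y huv hwy hne a b c d ha hb hc hd h
    have huv := huv.ne
    have hwy := hwy.ne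
    fin_cases u <;> fin_cases v <;> simp at huv <;> fin_cases w <;> fin_cases y <;>
      simp at hwy <;> simp [trianglePoint] at h hne <;> linarith

/-- The quadrangle on the fixed circle. -/
noncomputable def quadranglePoint : Fin 4 → ℝ × ℝ := ![(1, 0), (0, 1), (-1, 0), (0, -1)]

/-- Different parities mean consecutive vertices, so each edge is a quarter of the circle. -/
theorem isCircleDrawing_quadrangle {H : SimpleGraph (Fin 4)}
    (hH : ∀ u v, H.Adj u v → parity u ≠ parity v) : IsCircleDrawing H quadranglePoint := by
  refine .of_pos ?_ ?_ ?_ ?_ ?_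
  · intro w
    fin_cases w
    · exact admissible_of_three_mul_abs_lt (by norm_num [quadranglePoint])
    · exact admissible_of_two_mul_abs_lt (by norm_num [quadranglePoint])
    · exact admissible_of_three_mul_abs_lt (by norm_num [quadranglePoint])
    · exact admissible_of_two_mul_abs_lt (by norm_num [quadranglePoint])
  · intro u v a huv ha h
    fin_cases u <;> fin_cases v <;> simp [quadranglePoint] at h huv <;> linarith
  · intro u v huv a b ha hb h
    have huv := hH u v huv
    fin_cases u <;> fin_cases v <;> simp [parity] at huv <;> simp [quadranglePoint] at h <;>
      linarith
  · intro u v w huv hwu hwv a b ha hb h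
    have huv := hH u v huv
    fin_cases u <;> fin_cases v <;> simp [parity] at huv <;> fin_cases w <;>
      simp [quadranglePoint] at h hwu hwv <;> linarith
  · intro u v w y huv hwy hne a b c d ha hb hc hd h
    have huv := hH u v huv
    have hwy := hH w y hwy
    fin_cases u <;> fin_cases v <;> simp [parity] at huv <;> fin_cases w <;> fin_cases y <;>
      simp [parity] at hwy <;> simp [quadranglePoint] at h hne <;> linarith

/-! ### Orbit counts and the five cases -/

theorem sum_pow_one (r i : Fin 3) :
    (∑ k : Fin 4, if ((1 : Equiv.Perm (Fin 3)) ^ (k : ℕ)) r = i then 1 else 0) =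
      if r = i then 4 else 0 := by
  revert r i; decide

theorem sum_pow_swap (r i : Fin 3) :
    (∑ k : Fin 4, if ((Equiv.swap (0 : Fin 3) 1) ^ (k : ℕ)) r = i then 1 else 0) =
      if r = 2 then (if i = 2 then 4 else 0) else if i = 2 then 0 else 2 := by
  revert r i; decide

theorem theorem1 {V : Type*} (γ : SimpleGraph V) {k₁ k₂ k₃ : ℕ}
    (a : Fin k₁ → ℕ) (b : Fin k₂ → ℕ) (c : Fin k₃ → ℕ) (q : Fin 3 → ℕ)
    (hγ : Nonempty (γ ≃g
      ((((completeMultipartite a).joinCopies 4).join ((completeMultipartite b).joinCopies 2)).join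
        (completeMultipartite c)).join (completeMultipartite q)))
    (hb : ∀ i, Even (b i)) (hc : ∀ i, 4 ∣ c i)
    (hq : ∃ σ : Equiv.Perm (Fin 3),
      (q (σ 1) = 0 ∧ q (σ 2) = 0) ∨
      (Odd (q (σ 0)) ∧ q (σ 1) = q (σ 0) ∧ q (σ 2) = 0) ∨
      (Odd (q (σ 0)) ∧ q (σ 1) = q (σ 0) ∧ q (σ 2) ≡ 1 [MOD 4] ∧ ∀ i, a i = 0) ∨
      (q (σ 0) ≡ 2 [MOD 4] ∧ q (σ 1) ≡ 1 [MOD 4] ∧ q (σ 2) = 0) ∨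
      (q (σ 0) ≡ 2 [MOD 4] ∧ q (σ 1) ≡ 2 [MOD 4] ∧ q (σ 2) = 0 ∧ ∀ i, a i = 0)) :
    γ.AchirallyEmbeddable := by
  have hswap : Equiv.swap (0 : Fin 3) 1 * Equiv.swap 0 1 = 1 := Equiv.swap_mul_self 0 1
  obtain ⟨σ, ⟨h1, h2⟩ | ⟨h0, h1, h2⟩ | ⟨h0, h1, h2, ha⟩ | ⟨h0, h1, h2⟩ | ⟨h0, h1, h2, ha⟩⟩ := hq
  -- At most three vertices of the single part remain after removing orbits; they carry no edges and
  -- go near a pole.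
  · have hn : q (σ 0) % 4 ≤ 3 := by omega
    refine achirallyEmbeddable_of_circleDrawing hγ hb hc σ 1 rfl (fun _ : Fin (q (σ 0) % 4) => 0)
      ![q (σ 0) / 4, 0, 0] (fun i => ?_) (nearPole _) (isCircleDrawing_nearPole hn (by simp))
      Fin.rev nearPole_rev (by simp)
      (Or.inr fun w y _ c d hc hd => nearPole_cone hn w y hc hd)
    simp only [sum_pow_one]
    fin_cases i <;> simp [h1, h2]
    omega
  · obtain ⟨l, hl⟩ := h0
    -- Each of the `l` orbits alternates between the two equal parts of size 2l + 1. One vertex of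
    -- each part remains, and the symmetry swaps these two.
    refine achirallyEmbeddable_of_circleDrawing hγ hb hc σ (Equiv.swap 0 1) hswap
      (n := 2) ![0, 1] ![l, 0, 0] (fun i => ?_) (nearPole _)
      (isCircleDrawing_nearPole (by norm_num) (by simp)) Fin.rev nearPole_rev (by decide)
      (Or.inr fun w y _ c d hc hd => nearPole_cone (by norm_num) w y hc hd)
    simp only [sum_pow_swap]
    fin_cases i <;> simp [Fin.sum_univ_three, Fin.sum_univ_two, h1, h2, hl, -Finset.sum_boole] <;> omega
  · obtain ⟨l, hl⟩ := h0
    -- As before, with one more vertex left in the third part; it takes the fixed point (0, 1),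
    -- opposite the swapped pair.
    refine achirallyEmbeddable_of_circleDrawing hγ hb hc σ (Equiv.swap 0 1) hswap
      (n := 3) ![2, 0, 1] ![l, 0, q (σ 2) / 4] (fun i => ?_) trianglePoint
      (isCircleDrawing_triangle _) ![0, 2, 1] (fun w => ?_) (by decide) (Or.inl ha)
    · simp only [sum_pow_swap]
      unfold Nat.ModEq at h2
      fin_cases i <;> simp [Fin.sum_univ_three, h1, hl, -Finset.sum_boole] <;> omega
    · fin_cases w <;> simp [trianglePoint]
  -- The remainder K_{2,1} is a path near the pole: its middle vertex is fixed and its ends, in one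
  -- part, are swapped.
  · refine achirallyEmbeddable_of_circleDrawing hγ hb hc σ 1 rfl
      (n := 3) ![0, 1, 0] ![q (σ 0) / 4, q (σ 1) / 4, 0] (fun i => ?_) (nearPole _)
      (isCircleDrawing_nearPole le_rfl (by simp; decide)) Fin.rev nearPole_rev (by decide)
      (Or.inr fun w y _ c d hc hd => nearPole_cone le_rfl w y hc hd)
    simp only [sum_pow_one]
    unfold Nat.ModEq at h0 h1
    fin_cases i <;> simp [Fin.sum_univ_three, h2, -Finset.sum_boole] <;> omega
  -- The remainder K_{2,2} is a 4-cycle filling the circle; the symmetry swaps the two vertices of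
  -- one part and fixes those of the other.
  · refine achirallyEmbeddable_of_circleDrawing hγ hb hc σ 1 rfl
      (n := 4) ![0, 1, 0, 1] ![q (σ 0) / 4, q (σ 1) / 4, 0] (fun i => ?_) quadranglePoint
      (isCircleDrawing_quadrangle (by simp; decide)) ![2, 1, 0, 3] (fun w => ?_) (by decide)
      (Or.inl ha)
    · simp only [sum_pow_one]
      unfold Nat.ModEq at h0 h1
      fin_cases i <;> simp [Fin.sum_univ_four, h2, -Finset.sum_boole] <;> omega
    · fin_cases w <;> simp [quadranglePoint]
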